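/- **Setting.** There are $N$ arms. In each round $t=0,\dots,T-1$ a set $Z(t)\subseteq\{1,\dots,N\}$ of available arms is drawn from a fixed distribution $P_Z$, and independently each arm $i$ draws a reward $X_i(t)\in\{0,1\}$, Bernoulli with mean $u_i$, all draws being independent over arms and rounds. Arm $i$ has a weight $w_i\ge 0$; let $w_{\max}=\max_i w_i$. A player who pulls $A(t)\subseteq Z(t)$ with $|A(t)|\le m$ collects $\sum_{i\in A(t)}w_iX_i(t)$ and observes $X_i(t)$ for $i\in A(t)$. Given a fairness vector $\mathbf k\in\mathbb R^N$, let $q^*$ be an optimal stationary randomized policy (pull $A\subseteq S$, $|A|\le m$, with probability $q^*_S(A)$ when $Z(t)=S$), i.e. one that maximizes the expected weighted reward per round $\sum_S P_Z(S)\sum_A q_S(A)\sum_{i\in A}w_iu_i$ subject to pulling each arm $i$ with probability at least $k_i$ per round; let $A^*(t)$ be the set it pulls in round $t$. **Algorithm (TSCSF-B), $0<\eta\le\infty$.** Let $\alpha_i(t)$ (resp. $\beta_i(t)$) be one plus the number of rewards $1$ (resp. $0$) observed from arm $i$ before round $t$, and $Q_i(t)=\max\{t k_i-\#\{\tau<t: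 i\in A(\tau)\},0\}$. In round $t$, draw $\theta_i(t)\sim\mathrm{Beta}(\alpha_i(t),\beta_i(t))$, independently given the past, and pull $$A(t)\in\operatorname*{argmax}_{A\subseteq Z(t),\ |A|\le m}\ \sum_{i\in A}\Big(\tfrac1\eta Q_i(t)+w_i\theta_i(t)\Big),$$ ties being broken arbitrarily (possibly at random, based on the past, $Z(t)$ and the samples), where $\tfrac1\eta=0$ for $\eta=\infty$. Its time-averaged regret is $$\mathcal R(T)=\mathbb E\Big[\frac1T\sum_{t=0}^{T-1}\Big(\sum_{i\in A^*(t)}w_iX_i(t)-\sum_{i\in A(t)}w_iX_i(t)\Big)\Big].$$ **Corollary 1.** There are absolute constants $C>0$ and $c\in\mathbb N$ such that for all integers $1\le m\le N\le T$ with $T>1$, all $P_Z$, all means $u_i\in[0,1]$ and all weights $w_i\ge 0$ the following holds. 1. For every $\mathbf k$ for which such an optimal policy $q^*$ exists, every choice of $q^*$, and every real $\eta\ge\sqrt{NT/(m\ln T)}$, $$\mathcal R(T)\le C(1+w_{\max})(\ln T)^c\,\frac{\sqrt{mNT}}{T}=\widetilde O\Big(\frac{\sqrt{mNT}}{T}\Big).$$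 More precisely, $$\mathcal R(T)\le\frac N{2\eta}+C\,w_{\max}(\ln T)^c\,\frac{\sqrt{mNT}}T,\qquad\text{where}\qquad \frac N{2\eta}\le\frac12\sqrt{\ln T}\,\frac{\sqrt{mNT}}T,$$ so the fairness term $N/(2\eta)$ is of no larger order in $N,m,T$ (up to logarithmic factors) than the learning term. 2. For $\eta=\infty$ and no fairness constraints ($\mathbf k=0$), i.e. for Thompson sampling on combinatorial sleeping semi-bandits compared with the unconstrained optimal policy, $$\mathcal R(T)\le C\,w_{\max}(\ln T)^c\,\frac{\sqrt{mNT}}T .$$ -/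

import Mathlib

open MeasureTheory ProbabilityTheory
open scoped ENNReal

noncomputable section

namespace CSMAB

/-- A combinatorial sleeping semi-bandit with `N` arms: the availability distribution on sets of
arms, the Bernoulli mean of the reward of every arm, and the non-negative weights. -/
structure Bandit (N : ℕ) where
  /-- the distribution of the set of available arms -/
  availability : PMF (Finset (Fin N))
  /-- the mean rewards -/
  mean : Fin N → ℝ
  mean_mem : ∀ i, mean i ∈ Set.Icc (0 : ℝ) 1
  /-- the weights -/
  weight : Fin N → ℝ
  weight_nonneg : ∀ i, 0 ≤ weight i

/-- The largest weight. -/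
def Bandit.maxWeight {N : ℕ} (B : Bandit N) : ℝ := ⨆ i, B.weight i

/-- The sets of arms that may be pulled when the arms in `S` are available: subsets of `S` with at
most `m` elements. -/
def actions {N : ℕ} (m : ℕ) (S : Finset (Fin N)) : Finset (Finset (Fin N)) :=
  S.powerset.filter fun A => A.card ≤ m

/-! ### The benchmark: optimal randomized policies under fairness constraints -/

/-- A stationary randomized policy: when the arms in `S` are available it pulls the set `A` with
probability `q S A`. -/
abbrev Policy (N : ℕ) := Finset (Fin N) → PMF (Finset (Fin N))

/-- The constraints: only admissible sets are pulled, and arm `i` is pulled with probability at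
least `k i` in every round. -/
def IsFeasible {N : ℕ} (B : Bandit N) (m : ℕ) (k : Fin N → ℝ) (q : Policy N) : Prop :=
  (∀ S A, q S A ≠ 0 → A ∈ actions m S) ∧
  ∀ i, k i ≤ ∑ S, (B.availability S).toReal *
    ∑ A ∈ (actions m S).filter (fun A => i ∈ A), (q S A).toReal

/-- The expected weighted reward per round of a policy. -/
def policyValue {N : ℕ} (B : Bandit N) (m : ℕ) (q : Policy N) : ℝ :=
  ∑ S, (B.availability S).toReal *
    ∑ A ∈ actions m S, (q S A).toReal * ∑ i ∈ A, B.weight i * B.mean i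

/-- `q` is an optimal policy among those that satisfy the fairness constraints `k`. -/
def IsOptimalPolicy {N : ℕ} (B : Bandit N) (m : ℕ) (k : Fin N → ℝ) (q : Policy N) : Prop :=
  IsFeasible B m k q ∧ ∀ q', IsFeasible B m k q' → policyValue B m q' ≤ policyValue B m q

/-! ### Histories -/

/-- The record of one round. -/
structure Round (N : ℕ) where
  /-- the available arms `Z(t)` -/
  avail : Finset (Fin N)
  /-- the arms `A(t)` pulled by the algorithm -/
  pulled : Finset (Fin N)
  /-- the arms `A*(t)` pulled by the optimal policy -/
  optimal : Finset (Fin N)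
  /-- the rewards `X(t)` of all the arms, `true` for one and `false` for zero -/
  reward : Fin N → Bool

/-- A record is a tuple of its four components. -/
def Round.equiv (N : ℕ) : Round N ≃
    Finset (Fin N) × Finset (Fin N) × Finset (Fin N) × (Fin N → Bool) where
  toFun r := (r.avail, r.pulled, r.optimal, r.reward)
  invFun p := ⟨p.1, p.2.1, p.2.2.1, p.2.2.2⟩
  left_inv _ := rfl
  right_inv _ := rfl

instance (N : ℕ) : Fintype (Round N) := Fintype.ofEquiv _ (Round.equiv N).symm

/-- The records of the rounds `0, …, t - 1`. -/
abbrev History (N t : ℕ) := Fin t → Round N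

variable {N : ℕ}

/-- The reward of an arm as a real number. -/
def Round.X (r : Round N) (i : Fin N) : ℝ := if r.reward i then 1 else 0

/-- The first Beta parameter `α_i(t)`: one plus the number of rewards `1` seen from arm `i`. -/
def alpha {t : ℕ} (h : History N t) (i : Fin N) : ℝ :=
  1 + ∑ s, if i ∈ (h s).pulled then (h s).X i else 0

/-- The second Beta parameter `β_i(t)`: one plus the number of rewards `0` seen from arm `i`. -/
def beta {t : ℕ} (h : History N t) (i : Fin N) : ℝ :=
  1 + ∑ s, if i ∈ (h s).pulled then 1 - (h s).X i else 0

/-- The virtual queue length `Q_i(t)`. -/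
def queue (k : Fin N → ℝ) {t : ℕ} (h : History N t) (i : Fin N) : ℝ :=
  max (t * k i - ∑ s, if i ∈ (h s).pulled then 1 else 0) 0

/-! ### The algorithm

The parameter `lam` stands for `1 / η`; the value `lam = 0` is the case `η = ∞`. -/

/-- The quantity that the algorithm maximizes in each round. -/
def objective (B : Bandit N) (k : Fin N → ℝ) (lam : ℝ) {t : ℕ} (h : History N t)
    (θ : Fin N → ℝ) (A : Finset (Fin N)) : ℝ :=
  ∑ i ∈ A, (lam * queue k h i + B.weight i * θ i)

/-- A rule that pulls a maximizer of the objective in each round, given the history, the available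
arms and the posterior samples. Ties may be broken in any (measurable) way, also at random. -/
structure ArgmaxRule (B : Bandit N) (m : ℕ) (k : Fin N → ℝ) (lam : ℝ) where
  /-- the conditional distribution of the set of pulled arms -/
  select : (t : ℕ) → History N t → Finset (Fin N) → (Fin N → ℝ) → PMF (Finset (Fin N))
  measurable_select : ∀ t h S A, Measurable fun θ => select t h S θ A
  select_mem : ∀ t h S θ A, select t h S θ A ≠ 0 → A ∈ actions m S
  select_max : ∀ t h S θ A, select t h S θ A ≠ 0 → ∀ A' ∈ actions m S,
    objective B k lam h θ A' ≤ objective B k lam h θ A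

/-- The joint distribution of the posterior samples `θ_i(t)`, which are independent and
`Beta(α_i(t), β_i(t))`-distributed given the history. -/
def sampleLaw {t : ℕ} (h : History N t) : Measure (Fin N → ℝ) :=
  Measure.pi fun i => betaMeasure (alpha h i) (beta h i)

lemma Round.X_nonneg (r : Round N) (i : Fin N) : 0 ≤ r.X i := by
  unfold Round.X; split_ifs <;> norm_num

lemma Round.X_le_one (r : Round N) (i : Fin N) : r.X i ≤ 1 := by
  unfold Round.X; split_ifs <;> norm_num

lemma alpha_pos {t : ℕ} (h : History N t) (i : Fin N) : 0 < alpha h i := by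
  have : 0 ≤ ∑ s, if i ∈ (h s).pulled then (h s).X i else 0 :=
    Finset.sum_nonneg fun s _ => by
      split_ifs
      · exact (h s).X_nonneg i
      · exact le_rfl
  unfold alpha; linarith

lemma beta_pos {t : ℕ} (h : History N t) (i : Fin N) : 0 < beta h i := by
  have : 0 ≤ ∑ s, if i ∈ (h s).pulled then 1 - (h s).X i else 0 :=
    Finset.sum_nonneg fun s _ => by
      split_ifs
      · linarith [(h s).X_le_one i]
      · exact le_rfl
  unfold beta; linarith

instance {t : ℕ} (h : History N t) : IsProbabilityMeasure (sampleLaw h) := by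
  have : ∀ i, IsProbabilityMeasure (betaMeasure (alpha h i) (beta h i)) := fun i =>
    isProbabilityMeasureBeta (alpha_pos h i) (beta_pos h i)
  unfold sampleLaw; infer_instance

/-- The distribution of the set `A(t)` of pulled arms given the history and the available arms:
draw the posterior samples, then apply the rule. -/
def actionLaw {B : Bandit N} {m : ℕ} {k : Fin N → ℝ} {lam : ℝ} (R : ArgmaxRule B m k lam)
    {t : ℕ} (h : History N t) (S : Finset (Fin N)) : PMF (Finset (Fin N)) :=
  PMF.ofFintype (fun A => ∫⁻ θ, R.select t h S θ A ∂(sampleLaw h)) (by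
    rw [← lintegral_finsetSum _ fun A _ => R.measurable_select t h S A]
    have (θ : Fin N → ℝ) : ∑ A, R.select t h S θ A = 1 := by
      rw [← tsum_fintype (L := .unconditional _)]; exact (R.select t h S θ).tsum_coe
    simp [this])

/-- The joint distribution of the rewards in a round: independent Bernoulli variables. -/
def rewardLaw (B : Bandit N) : PMF (Fin N → Bool) :=
  PMF.ofFintype (fun x => ∏ i, ENNReal.ofReal (if x i then B.mean i else 1 - B.mean i)) (by
    rw [← Fintype.prod_sum fun (i : Fin N) (b : Bool) =>
      ENNReal.ofReal (if b then B.mean i else 1 - B.mean i)]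
    refine Finset.prod_eq_one fun i _ => ?_
    have h0 := (B.mean_mem i).1
    have h1 : 0 ≤ 1 - B.mean i := sub_nonneg.2 (B.mean_mem i).2
    simp [← ENNReal.ofReal_add h0 h1])

/-- The distribution of the record of round `t` given the history. -/
def roundLaw {B : Bandit N} {m : ℕ} {k : Fin N → ℝ} {lam : ℝ} (R : ArgmaxRule B m k lam)
    (q : Policy N) {t : ℕ} (h : History N t) : PMF (Round N) :=
  B.availability.bind fun S => (actionLaw R h S).bind fun A => (q S).bind fun Aopt =>
    (rewardLaw B).map fun x => ⟨S, A, Aopt, x⟩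

/-- The distribution of the history of the first `t` rounds, when the algorithm and the randomized
policy `q` are run side by side on the same availability sets and rewards. -/
def historyLaw {B : Bandit N} {m : ℕ} {k : Fin N → ℝ} {lam : ℝ} (R : ArgmaxRule B m k lam)
    (q : Policy N) : (t : ℕ) → PMF (History N t)
  | 0 => PMF.pure Fin.elim0
  | t + 1 => (historyLaw R q t).bind fun h => (roundLaw R q h).map fun r => Fin.snoc h r

/-- The time-averaged regret of the algorithm over the rounds `0, …, T - 1` with respect to the
policy `q`: the expectation of the averaged difference of the collected weighted rewards. -/
def regret {B : Bandit N} {m : ℕ} {k : Fin N → ℝ} {lam : ℝ} (R : ArgmaxRule B m k lam)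
    (q : Policy N) (T : ℕ) : ℝ :=
  ∑ h : History N T, (historyLaw R q T h).toReal *
    ((1 / (T : ℝ)) * ∑ t, ((∑ i ∈ (h t).optimal, B.weight i * (h t).X i) -
      ∑ i ∈ (h t).pulled, B.weight i * (h t).X i))

end CSMAB

end

/-!
The regret of a round against the benchmark set is split by shifting the mean of each arm by its
queue term `lam * Q i`. The shifts cost `lam * ∑ i, Q i * (P(i pulled) - k i)` in expectation, since
the benchmark pulls arm `i` with probability at least `k i` whatever the past; the quadratic
Lyapunov function of the queues bounds the sum of this over the rounds by `lam * N * T / 2`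
(`sum_expect_queue_le`).

The rest is the regret of Thompson sampling with shifted scores. For fixed samples the pulled set
consists of the arms above a threshold, so its loss comes from passed-over arms whose samples are
too low and from pulled arms whose samples are too high (`sum_sub_sum_le`). The errors are compared
with dyadic levels `x`; an arm with mean `u` is sampled too low if its sample is below `u - x` and
too high if it is above `u + x`.

* Too low. An arm that is passed over has an open slot: fewer than `m` other arms reach the score
  it has at `u - x`. This does not depend on its own sample, and with an open slot it is pulled
  whenever its sample exceeds `u - x`, which has a posterior probability `p`. So it is passed over
  at most `(1 - p) / p` times as often as it is pulled (`openSlot_inter_lt_le`, regularized by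
  a small `δ` in the denominator).
* Too high. This is charged to the pull of the arm while there are few pulls of it, and to the tail
  of the posterior afterwards (`integral_indicator_mul_expect_le`).

Every charge depends only on the success and failure counts of the arm, which move only when the
arm is pulled and then as in a sequence of Bernoulli trials. Hence the total charge is at most a
sum of binomial expectations (`sum_expect_mul_pulls_le`, `expect_counts_le`).

Beta tails are binomial distribution functions (`betaMeasure_Ioi`). For a binomial variable `S` with
distribution function `F`, the expectation of `1 / (F(S) + δ)` is logarithmic in `1 / δ`, because
the sum of the ratios of increments to values telescopes under the logarithm
(`sum_binomWeight_div_le`). Comparing `p` with `F` loses a factor `q = 1 - (u - x)`, but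
the Chernoff bounds show that the posterior is concentrated after `q * log T / x ^ 2` pulls, and
the factor `q` cancels. So the charges of an arm at the level `x` are `O(log T ^ 2 / x ^ 2)`
(`pathSum_missRatio_le`, `pathSum_fewPulls_le`). Summing `x` times this over the arms and over
the levels `x ≥ ε` gives `N * log T ^ 2 / ε`, the smaller errors cost `m * T * ε`, and
`ε = √(N / (m * T))` balances the two.
-/

namespace CSMAB

/-! ### Binomial weights and their distribution function -/

/-- The probability that a binomial variable with parameters `n` and `u` equals `k`. -/
noncomputable def binomWeight (n : ℕ) (u : ℝ) (k : ℕ) : ℝ :=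
  n.choose k * u ^ k * (1 - u) ^ (n - k)

/-- The probability that a binomial variable with parameters `n` and `u` is at most `s`. -/
noncomputable def binomCDF (n : ℕ) (u : ℝ) (s : ℕ) : ℝ :=
  ∑ k ∈ Finset.range (s + 1), binomWeight n u k

/-- The expectation of `f S (n - S)` for a binomial variable `S` with parameters `n` and `u`,
i.e. of a function of the numbers of successes and failures in `n` trials. -/
noncomputable def binomMean (u : ℝ) (n : ℕ) (f : ℕ → ℕ → ℝ) : ℝ :=
  ∑ k ∈ Finset.range (n + 1), binomWeight n u k * f k (n - k)

lemma binomWeight_nonneg {u : ℝ} (h0 : 0 ≤ u) (h1 : u ≤ 1) (n k : ℕ) : 0 ≤ binomWeight n u k := by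
  have : 0 ≤ 1 - u := by linarith
  unfold binomWeight; positivity

lemma sum_binomWeight_mul_pow (n : ℕ) (u z : ℝ) :
    ∑ k ∈ Finset.range (n + 1), binomWeight n u k * z ^ k = (1 - u + u * z) ^ n := by
  rw [add_comm (1 - u), add_pow]
  refine Finset.sum_congr rfl fun k _ => ?_
  rw [binomWeight, mul_pow]; ring

lemma sum_binomWeight (n : ℕ) (u : ℝ) : ∑ k ∈ Finset.range (n + 1), binomWeight n u k = 1 := by
  simpa using sum_binomWeight_mul_pow n u 1

lemma binomCDF_self (n : ℕ) (u : ℝ) : binomCDF n u n = 1 := sum_binomWeight n u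

lemma binomCDF_nonneg {u : ℝ} (h0 : 0 ≤ u) (h1 : u ≤ 1) (n s : ℕ) : 0 ≤ binomCDF n u s :=
  Finset.sum_nonneg fun _ _ => binomWeight_nonneg h0 h1 _ _

lemma binomCDF_le_one {u : ℝ} (h0 : 0 ≤ u) (h1 : u ≤ 1) {n s : ℕ} (hs : s ≤ n) :
    binomCDF n u s ≤ 1 := by
  rw [← binomCDF_self n u]
  exact Finset.sum_le_sum_of_subset_of_nonneg (by simpa using hs)
    fun _ _ _ => binomWeight_nonneg h0 h1 _ _

lemma binomMean_mono {u : ℝ} (h0 : 0 ≤ u) (h1 : u ≤ 1) {n : ℕ} {f g : ℕ → ℕ → ℝ}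
    (h : ∀ s r, s + r = n → f s r ≤ g s r) : binomMean u n f ≤ binomMean u n g :=
  Finset.sum_le_sum fun k hk => mul_le_mul_of_nonneg_left
    (h _ _ (by have := Finset.mem_range.1 hk; omega)) (binomWeight_nonneg h0 h1 _ _)

lemma binomMean_const (u : ℝ) (n : ℕ) (c : ℝ) : binomMean u n (fun _ _ => c) = c := by
  rw [binomMean, ← Finset.sum_mul, sum_binomWeight, one_mul]

lemma binomMean_const_mul (u : ℝ) (n : ℕ) (c : ℝ) (f : ℕ → ℕ → ℝ) :
    binomMean u n (fun s r => c * f s r) = c * binomMean u n f := by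
  simp only [binomMean, Finset.mul_sum]
  exact Finset.sum_congr rfl fun _ _ => by ring

lemma binomMean_nonneg {u : ℝ} (h0 : 0 ≤ u) (h1 : u ≤ 1) {n : ℕ} {f : ℕ → ℕ → ℝ}
    (h : ∀ s r, 0 ≤ f s r) : 0 ≤ binomMean u n f :=
  Finset.sum_nonneg fun _ _ => mul_nonneg (binomWeight_nonneg h0 h1 _ _) (h _ _)

lemma binomMean_eq_sum_antidiagonal (u : ℝ) (n : ℕ) (f : ℕ → ℕ → ℝ) :
    binomMean u n f = ∑ p ∈ Finset.HasAntidiagonal.antidiagonal n,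
      (n.choose p.1 : ℝ) * (u ^ p.1 * (1 - u) ^ p.2 * f p.1 p.2) := by
  rw [Finset.Nat.sum_antidiagonal_eq_sum_range_succ_mk]
  exact Finset.sum_congr rfl fun k _ => by rw [binomWeight]; ring

/-- Conditioning on the first trial. -/
lemma binomMean_succ (u : ℝ) (n : ℕ) (f : ℕ → ℕ → ℝ) :
    binomMean u (n + 1) f = u * binomMean u n (fun s r => f (s + 1) r) +
      (1 - u) * binomMean u n (fun s r => f s (r + 1)) := by
  simp only [binomMean_eq_sum_antidiagonal]
  rw [Finset.sum_antidiagonal_choose_succ_mul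
    (fun a b => u ^ a * (1 - u) ^ b * f a b) n, add_comm, Finset.mul_sum, Finset.mul_sum]
  congr 1
  · refine Finset.sum_congr rfl fun p hp => ?_
    have h : p.1 + p.2 = n := by simpa using hp
    rw [← h, ← Nat.choose_symm_add]; ring
  · exact Finset.sum_congr rfl fun p _ => by ring

lemma hasDerivAt_binomWeight_zero (n : ℕ) (y : ℝ) :
    HasDerivAt (fun y => binomWeight (n + 1) y 0) (-(n + 1) * binomWeight n y 0) y := by
  have h := (((hasDerivAt_id y).const_sub 1).pow (n + 1))
  have e : (fun y : ℝ => binomWeight (n + 1) y 0) = ((fun x : ℝ => 1 - id x) ^ (n + 1)) := by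
    funext z; simp [binomWeight]
  rw [e]
  refine h.congr_deriv ?_
  simp [binomWeight]; ring

lemma hasDerivAt_binomWeight_succ (n k : ℕ) (y : ℝ) :
    HasDerivAt (fun y => binomWeight (n + 1) y (k + 1))
      ((n + 1) * (binomWeight n y k - binomWeight n y (k + 1))) y := by
  rcases lt_trichotomy k n with hk | hk | hk
  · obtain ⟨d, rfl⟩ : ∃ d, n = k + 1 + d := ⟨n - (k + 1), by omega⟩
    have h := (((hasDerivAt_id y).pow (k + 1)).mul
      (((hasDerivAt_id y).const_sub 1).pow (d + 1))).const_mul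
        (((k + 1 + d + 1).choose (k + 1) : ℕ) : ℝ)
    have e1 : ((k + 1 + d + 1).choose (k + 1) : ℝ) * (k + 1) =
        (k + 1 + d + 1) * (k + 1 + d).choose k := by
      exact_mod_cast (Nat.add_one_mul_choose_eq (k + 1 + d) k).symm
    have e2 : ((k + 1 + d + 1).choose (k + 1) : ℝ) * (d + 1) =
        (k + 1 + d + 1) * (k + 1 + d).choose (k + 1) := by
      have := Nat.choose_mul_succ_eq (k + 1 + d) (k + 1)
      rw [show k + 1 + d + 1 - (k + 1) = d + 1 by omega] at this
      have h' : (((k + 1 + d).choose (k + 1) : ℕ) : ℝ) * (k + 1 + d + 1) =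
        ((k + 1 + d + 1).choose (k + 1) : ℕ) * (d + 1) := by exact_mod_cast this
      linarith
    have e : (fun y : ℝ => binomWeight (k + 1 + d + 1) y (k + 1)) = fun y : ℝ =>
        (((k + 1 + d + 1).choose (k + 1) : ℕ) : ℝ) *
          (((id : ℝ → ℝ) ^ (k + 1) * (fun x : ℝ => 1 - id x) ^ (d + 1)) y) := by
      funext z
      simp only [binomWeight, Pi.mul_apply, Pi.pow_apply, id]
      rw [show k + 1 + d + 1 - (k + 1) = d + 1 by omega, mul_assoc]
    rw [e]
    refine h.congr_deriv ?_
    simp only [binomWeight, Pi.pow_apply, id]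
    rw [show k + 1 + d - k = d + 1 by omega, show k + 1 + d - (k + 1) = d by omega]
    push_cast
    linear_combination (y ^ k * (1 - y) ^ (d + 1)) * e1 - (y ^ (k + 1) * (1 - y) ^ d) * e2
  · subst hk
    have h := (hasDerivAt_id y).pow (k + 1)
    have e : (fun y : ℝ => binomWeight (k + 1) y (k + 1)) = id ^ (k + 1) := by
      funext z; simp [binomWeight]
    rw [e]
    refine h.congr_deriv ?_
    simp [binomWeight]
  · have e : (fun y : ℝ => binomWeight (n + 1) y (k + 1)) = fun _ => 0 := by
      funext z; simp [binomWeight, Nat.choose_eq_zero_of_lt (show n + 1 < k + 1 by omega)]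
    rw [e]
    refine (hasDerivAt_const y (0 : ℝ)).congr_deriv ?_
    simp [binomWeight, Nat.choose_eq_zero_of_lt (show n < k + 1 by omega),
        Nat.choose_eq_zero_of_lt hk]

/-- The derivatives of the weights telescope, so that the distribution function of `n + 1` trials
has, up to the constant, a Beta density as its derivative in the success probability. -/
lemma hasDerivAt_binomCDF (n s : ℕ) (y : ℝ) :
    HasDerivAt (fun y => binomCDF (n + 1) y s) (-(n + 1) * binomWeight n y s) y := by
  induction s with
  | zero => simpa [binomCDF] using hasDerivAt_binomWeight_zero n y
  | succ s ih =>
    have h := ih.add (hasDerivAt_binomWeight_succ n s y)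
    have e : (fun y : ℝ => binomCDF (n + 1) y (s + 1)) =
        (fun y => binomCDF (n + 1) y s) + fun y => binomWeight (n + 1) y (s + 1) := by
      funext z; simp only [binomCDF, Pi.add_apply]; rw [Finset.sum_range_succ]
    rw [e]
    exact h.congr_deriv (by ring)

lemma binomCDF_anti {n s : ℕ} {y u : ℝ} (h0 : 0 ≤ y) (hyu : y ≤ u) (h1 : u ≤ 1) (hs : s ≤ n) :
    binomCDF n u s ≤ binomCDF n y s := by
  cases n with
  | zero =>
    obtain rfl : s = 0 := by omega
    rw [binomCDF_self, binomCDF_self]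
  | succ n =>
    have : AntitoneOn (fun y => binomCDF (n + 1) y s) (Set.Icc 0 1) := by
      refine antitoneOn_of_deriv_nonpos (convex_Icc 0 1) ?_ ?_ ?_
      · exact fun z _ => (hasDerivAt_binomCDF n s z).continuousAt.continuousWithinAt
      · exact fun z _ => (hasDerivAt_binomCDF n s z).differentiableAt.differentiableWithinAt
      · intro z hz
        rw [interior_Icc] at hz
        rw [(hasDerivAt_binomCDF n s z).deriv]
        have := binomWeight_nonneg hz.1.le hz.2.le n s
        have h3 : (0 : ℝ) ≤ n + 1 := by positivity
        nlinarith
    exact this ⟨h0, hyu.trans h1⟩ ⟨h0.trans hyu, h1⟩ hyu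

lemma one_sub_mul_binomCDF_le {n s : ℕ} {y : ℝ} (h0 : 0 ≤ y) (h1 : y ≤ 1) (hs : s ≤ n) :
    (1 - y) * binomCDF n y s ≤ binomCDF (n + 1) y s := by
  have h2 : 0 ≤ 1 - y := by linarith
  rw [binomCDF, Finset.mul_sum]
  refine Finset.sum_le_sum fun k hk => ?_
  have hk : k ≤ n := by have := Finset.mem_range.1 hk; omega
  have : (n.choose k : ℝ) ≤ (n + 1).choose k := by exact_mod_cast Nat.choose_le_succ n k
  calc (1 - y) * binomWeight n y k = n.choose k * (y ^ k * (1 - y) ^ (n + 1 - k)) := by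
        rw [binomWeight, Nat.succ_sub hk, pow_succ]; ring
    _ ≤ (n + 1).choose k * (y ^ k * (1 - y) ^ (n + 1 - k)) := by gcongr
    _ = _ := by rw [binomWeight]; ring

/-- If `F` is the distribution function of `S`, then `𝔼[1 / (F(S) + δ)]` is at most logarithmic in
`1 / δ`: it is dominated by the integral of `1 / (v + δ)` over `v ∈ [0, 1]`. -/
lemma sum_binomWeight_div_le {u δ : ℝ} (h0 : 0 ≤ u) (h1 : u ≤ 1) (hδ : 0 < δ) (n : ℕ) :
    ∑ k ∈ Finset.range (n + 1), binomWeight n u k / (binomCDF n u k + δ) ≤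
      Real.log ((1 + δ) / δ) := by
  have key : ∀ s, ∑ k ∈ Finset.range (s + 1), binomWeight n u k / (binomCDF n u k + δ) ≤
      Real.log ((binomCDF n u s + δ) / δ) := by
    have step : ∀ a b : ℝ, 0 < a → 0 < b → (b - a) / b ≤ Real.log (b / δ) - Real.log (a / δ) := by
      intro a b ha hb
      rw [Real.log_div hb.ne' hδ.ne', Real.log_div ha.ne' hδ.ne']
      have := Real.log_le_sub_one_of_pos (div_pos ha hb)
      rw [Real.log_div ha.ne' hb.ne'] at this
      have e : (b - a) / b = 1 - a / b := by field_simp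
      linarith
    intro s
    induction s with
    | zero =>
      have hp := binomCDF_nonneg h0 h1 n 0
      have h := step δ (binomCDF n u 0 + δ) hδ (by linarith)
      rw [div_self hδ.ne', Real.log_one] at h
      simpa [binomCDF] using h
    | succ s ih =>
      have hp := binomCDF_nonneg h0 h1 n s
      have hp' := binomCDF_nonneg h0 h1 n (s + 1)
      have h := step (binomCDF n u s + δ) (binomCDF n u (s + 1) + δ) (by linarith) (by linarith)
      have e : binomCDF n u (s + 1) = binomCDF n u s + binomWeight n u (s + 1) := by
        rw [binomCDF, Finset.sum_range_succ]; rfl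
      rw [Finset.sum_range_succ]
      have e2 : binomCDF n u (s + 1) + δ - (binomCDF n u s + δ) = binomWeight n u (s + 1) := by
        linarith
      rw [e2] at h
      linarith
  simpa [binomCDF_self] using key n

/-- The exponent of the Chernoff bounds below. It is of order `x ^ 2 / q`, not just `x ^ 2`. -/
lemma chernoff_exponent_le {x q : ℝ} (hx : 0 < x) (hq : x ≤ q) :
    (q - x) * (Real.exp (x / (4 * q)) - 1) - q * (1 - Real.exp (-(x / (4 * q)))) ≤
      -(x ^ 2 / (8 * q)) := by
  have hq0 : 0 < q := hx.trans_le hq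
  set σ := x / (4 * q) with hσ
  have hσ0 : 0 < σ := by positivity
  have hσ1 : σ ≤ 1 := by rw [hσ, div_le_one (by positivity)]; linarith
  have hxs : x = 4 * q * σ := by rw [hσ]; field_simp
  have h1 : Real.exp σ - 1 ≤ σ + σ ^ 2 := by
    have := Real.abs_exp_sub_one_sub_id_le (x := σ) (by rw [abs_of_pos hσ0]; exact hσ1)
    linarith [(abs_le.1 this).2]
  have h2 : Real.exp (-σ) - 1 ≤ -σ + σ ^ 2 := by
    have := Real.abs_exp_sub_one_sub_id_le (x := -σ) (by rw [abs_neg, abs_of_pos hσ0]; exact hσ1)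
    have := (abs_le.1 this).2
    nlinarith
  have e : x ^ 2 / (8 * q) = 2 * q * σ ^ 2 := by
    rw [hxs]; field_simp; ring
  rw [e]
  have h3 : (q - x) * (Real.exp σ - 1) ≤ (q - x) * (σ + σ ^ 2) :=
    mul_le_mul_of_nonneg_left h1 (by linarith)
  have h4 : q * (Real.exp (-σ) - 1) ≤ q * (-σ + σ ^ 2) := mul_le_mul_of_nonneg_left h2 hq0.le
  have h5 : 0 ≤ x * σ ^ 2 := by positivity
  nlinarith [mul_pos hq0 (pow_pos hσ0 2)]

/-- The moment generating functions of two independent binomial variables, one of which has a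
success probability that is larger by `x`, combined with the Chernoff exponent. -/
lemma mgf_mul_mgf_le {x q : ℝ} (hx : 0 < x) (hq : x ≤ q) (hq1 : q ≤ 1) (n : ℕ) :
    (1 - (q - x) + (q - x) * Real.exp (x / (4 * q))) ^ n *
      (1 - q + q * Real.exp (-(x / (4 * q)))) ^ (n + 1) ≤ Real.exp (-(n * (x ^ 2 / (8 * q)))) := by
  have hq0 : 0 < q := hx.trans_le hq
  set σ := x / (4 * q) with hσ
  have hσ0 : 0 < σ := by positivity
  have hb : 1 - q + q * Real.exp (-σ) ≤ Real.exp (-(q * (1 - Real.exp (-σ)))) := by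
    have := Real.add_one_le_exp (-(q * (1 - Real.exp (-σ)))); linarith
  have hb0 : 0 ≤ 1 - q + q * Real.exp (-σ) := by
    have := mul_pos hq0 (Real.exp_pos (-σ)); linarith
  have hb1 : 1 - q + q * Real.exp (-σ) ≤ 1 := by
    have : Real.exp (-σ) ≤ 1 := Real.exp_le_one_iff.2 (by linarith)
    nlinarith
  have ha : 1 - (q - x) + (q - x) * Real.exp σ ≤ Real.exp ((q - x) * (Real.exp σ - 1)) := by
    have := Real.add_one_le_exp ((q - x) * (Real.exp σ - 1)); linarith
  have ha0 : 0 ≤ 1 - (q - x) + (q - x) * Real.exp σ := by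
    have : 0 ≤ (q - x) * Real.exp σ := mul_nonneg (by linarith) (Real.exp_pos σ).le
    linarith
  calc _ ≤ (1 - (q - x) + (q - x) * Real.exp σ) ^ n * (1 - q + q * Real.exp (-σ)) ^ n := by
        gcongr ?_ * ?_
        exact pow_le_pow_of_le_one hb0 hb1 (Nat.le_succ n)
    _ ≤ Real.exp ((q - x) * (Real.exp σ - 1)) ^ n *
        Real.exp (-(q * (1 - Real.exp (-σ)))) ^ n := by gcongr
    _ = Real.exp (n * ((q - x) * (Real.exp σ - 1) - q * (1 - Real.exp (-σ)))) := by
        rw [← Real.exp_nat_mul, ← Real.exp_nat_mul, ← Real.exp_add]; ring_nf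
    _ ≤ _ := by
        apply Real.exp_le_exp.2
        rw [← mul_neg]
        exact mul_le_mul_of_nonneg_left (chernoff_exponent_le hx hq) (Nat.cast_nonneg n)

/-- A binomial variable is rarely at least as large as an independent one with a success
probability that is larger by `x`. -/
lemma binomMean_binomCDF_le {u x : ℝ} (h0 : 0 ≤ u) (hx : 0 < x) (h1 : u + x ≤ 1) (n : ℕ) :
    binomMean u n (fun s _ => binomCDF (n + 1) (u + x) s) ≤
      Real.exp (-(n * (x ^ 2 / (8 * (u + x))))) := by
  refine le_trans ?_ (mgf_mul_mgf_le hx (by linarith : x ≤ u + x) h1 n)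
  rw [show u + x - x = u by ring]
  set σ := x / (4 * (u + x)) with hσ
  have hσ0 : 0 < σ := by positivity
  rw [← sum_binomWeight_mul_pow, ← sum_binomWeight_mul_pow, Finset.sum_mul, binomMean]
  refine Finset.sum_le_sum fun k hk => ?_
  rw [mul_assoc]
  have hk : k ≤ n := by have := Finset.mem_range.1 hk; omega
  refine mul_le_mul_of_nonneg_left ?_ (binomWeight_nonneg h0 (by linarith) _ _)
  rw [Finset.mul_sum, binomCDF]
  have hw := binomWeight_nonneg (u := u + x) (by linarith) h1 (n + 1)
  calc _ ≤ ∑ j ∈ Finset.range (k + 1),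
        Real.exp σ ^ k * (binomWeight (n + 1) (u + x) j * Real.exp (-σ) ^ j) := by
        refine Finset.sum_le_sum fun j hj => ?_
        have hj : j ≤ k := by have := Finset.mem_range.1 hj; omega
        have : 1 ≤ Real.exp σ ^ k * Real.exp (-σ) ^ j := by
          rw [← Real.exp_nat_mul, ← Real.exp_nat_mul, ← Real.exp_add]
          apply Real.one_le_exp
          have : (j : ℝ) ≤ k := by exact_mod_cast hj
          nlinarith
        nlinarith [hw j]
    _ ≤ _ := Finset.sum_le_sum_of_subset_of_nonneg (by
        intro j hj; simp only [Finset.mem_range] at *; omega)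
        fun j _ _ => mul_nonneg (by positivity) (mul_nonneg (hw j) (by positivity))

/-- A binomial variable is rarely smaller than an independent one with a success probability that
is smaller by `x`. The exponent has the failure probability in the denominator. -/
lemma binomMean_one_sub_binomCDF_le {u x : ℝ} (h0 : 0 ≤ u - x) (hx : 0 < x) (h1 : u ≤ 1) (n : ℕ) :
    binomMean u n (fun s _ => 1 - binomCDF (n + 1) (u - x) s) ≤
      Real.exp (-(n * (x ^ 2 / (8 * (1 - (u - x)))))) := by
  refine le_trans ?_ (mgf_mul_mgf_le hx (by linarith : x ≤ 1 - (u - x)) (by linarith) n)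
  set σ := x / (4 * (1 - (u - x))) with hσ
  have hσ0 : 0 < σ := div_pos hx (by linarith)
  have hw := binomWeight_nonneg h0 (by linarith) (n + 1)
  have ee : Real.exp σ * Real.exp (-σ) = 1 := by rw [← Real.exp_add]; simp
  -- pass from failures to successes
  have e : (1 - (1 - (u - x) - x) + (1 - (u - x) - x) * Real.exp σ) ^ n *
      (1 - (1 - (u - x)) + (1 - (u - x)) * Real.exp (-σ)) ^ (n + 1) =
      (1 - u + u * Real.exp (-σ)) ^ n *
        (Real.exp (-σ) * (1 - (u - x) + (u - x) * Real.exp σ) ^ (n + 1)) := by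
    have e1 : 1 - (1 - (u - x) - x) + (1 - (u - x) - x) * Real.exp σ =
        Real.exp σ * (1 - u + u * Real.exp (-σ)) := by linear_combination (-u) * ee
    have e2 : 1 - (1 - (u - x)) + (1 - (u - x)) * Real.exp (-σ) =
        Real.exp (-σ) * (1 - (u - x) + (u - x) * Real.exp σ) := by
      linear_combination (-(u - x)) * ee
    have e3 : Real.exp σ ^ n * Real.exp (-σ) ^ n = 1 := by rw [← mul_pow, ee, one_pow]
    rw [e1, e2, mul_pow, mul_pow, pow_succ (Real.exp (-σ))]
    linear_combination ((1 - u + u * Real.exp (-σ)) ^ n *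
        (Real.exp (-σ) * (1 - (u - x) + (u - x) * Real.exp σ) ^ (n + 1))) * e3
  rw [e, ← sum_binomWeight_mul_pow, ← sum_binomWeight_mul_pow, Finset.sum_mul, binomMean]
  refine Finset.sum_le_sum fun k hk => ?_
  rw [mul_assoc]
  have hk : k ≤ n := by have := Finset.mem_range.1 hk; omega
  refine mul_le_mul_of_nonneg_left ?_ (binomWeight_nonneg (by linarith) h1 _ _)
  rw [Finset.mul_sum, Finset.mul_sum]
  have hsplit : 1 - binomCDF (n + 1) (u - x) k =
      ∑ j ∈ Finset.Ico (k + 1) (n + 1 + 1), binomWeight (n + 1) (u - x) j := by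
    rw [Finset.sum_Ico_eq_sub _ (by omega), sum_binomWeight, binomCDF]
  rw [hsplit]
  calc _ ≤ ∑ j ∈ Finset.Ico (k + 1) (n + 1 + 1), Real.exp (-σ) ^ k *
        (Real.exp (-σ) * (binomWeight (n + 1) (u - x) j * Real.exp σ ^ j)) := by
        refine Finset.sum_le_sum fun j hj => ?_
        have hj := (Finset.mem_Ico.1 hj).1
        have : 1 ≤ Real.exp (-σ) ^ k * (Real.exp (-σ) * Real.exp σ ^ j) := by
          rw [← Real.exp_nat_mul, ← Real.exp_nat_mul, ← Real.exp_add, ← Real.exp_add]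
          apply Real.one_le_exp
          have : (k : ℝ) + 1 ≤ j := by exact_mod_cast hj
          nlinarith
        nlinarith [hw j]
    _ ≤ _ := Finset.sum_le_sum_of_subset_of_nonneg (by
        intro j hj; simp only [Finset.mem_range, Finset.mem_Ico] at *; omega)
        fun j _ _ => mul_nonneg (by positivity)
          (mul_nonneg (by positivity) (mul_nonneg (hw j) (by positivity)))

/-! ### Beta tails are binomial probabilities -/

lemma betaMeasure_Ioi_eq_lintegral (s r : ℕ) {y : ℝ} (h0 : 0 ≤ y) :
    betaMeasure (1 + s) (1 + r) (Set.Ioi y) = ∫⁻ x in Set.Ioo y 1,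
      ENNReal.ofReal (1 / ProbabilityTheory.beta (1 + s) (1 + r) * (x ^ s * (1 - x) ^ r)) := by
  rw [betaMeasure, withDensity_apply _ measurableSet_Ioi,
    ← lintegral_add_compl (μ := volume.restrict (Set.Ioi y)) _ (measurableSet_Ici (a := (1 : ℝ))),
    setLIntegral_eq_zero measurableSet_Ici (fun x (hx : 1 ≤ x) => betaPDF_eq_zero_of_one_le hx),
    zero_add, Set.compl_Ici, Measure.restrict_restrict measurableSet_Iio, Set.Iio_inter_Ioi]
  refine setLIntegral_congr_fun measurableSet_Ioo fun x hx => ?_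
  rw [betaPDF_of_pos_lt_one (h0.trans_lt hx.1) hx.2]
  simp [mul_assoc]

lemma betaMeasure_Iic_zero (a b : ℝ) : betaMeasure a b (Set.Iic 0) = 0 := by
  rw [betaMeasure, withDensity_apply _ measurableSet_Iic]
  exact setLIntegral_eq_zero measurableSet_Iic fun x (hx : x ≤ 0) => betaPDF_eq_zero_of_nonpos hx

lemma betaMeasure_Ici_one (a b : ℝ) : betaMeasure a b (Set.Ici 1) = 0 := by
  rw [betaMeasure, withDensity_apply _ measurableSet_Ici]
  exact setLIntegral_eq_zero measurableSet_Ici fun x (hx : 1 ≤ x) => betaPDF_eq_zero_of_one_le hx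

instance isProbabilityMeasure_betaMeasure_nat (s r : ℕ) :
    IsProbabilityMeasure (betaMeasure (1 + s) (1 + r)) :=
  isProbabilityMeasureBeta (by positivity) (by positivity)

lemma integral_pow_mul_one_sub_pow (s r : ℕ) (y : ℝ) :
    ((s + r + 1) * (s + r).choose s) * ∫ x in y..1, x ^ s * (1 - x) ^ r =
      binomCDF (s + r + 1) y s := by
  have hd : ∀ x ∈ Set.uIcc y 1, HasDerivAt (fun y => -binomCDF (s + r + 1) y s)
      (((s + r + 1) * (s + r).choose s) * (x ^ s * (1 - x) ^ r)) x := by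
    intro x _
    refine (hasDerivAt_binomCDF (s + r) s x).neg.congr_deriv ?_
    rw [binomWeight, Nat.add_sub_cancel_left]; push_cast; ring
  have h := intervalIntegral.integral_eq_sub_of_hasDerivAt hd
    (Continuous.intervalIntegrable (by fun_prop) _ _)
  rw [intervalIntegral.integral_const_mul] at h
  rw [h]
  have h1 : binomCDF (s + r + 1) 1 s = 0 := by
    refine Finset.sum_eq_zero fun k hk => ?_
    have : s + r + 1 - k ≠ 0 := by have := Finset.mem_range.1 hk; omega
    simp [binomWeight, this]
  rw [h1]; ring

/-- The tails of a Beta distribution with integer parameters are binomial probabilities. -/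
lemma betaMeasure_Ioi (s r : ℕ) {y : ℝ} (h0 : 0 ≤ y) (h1 : y ≤ 1) :
    (betaMeasure (1 + s) (1 + r)).real (Set.Ioi y) = binomCDF (s + r + 1) y s := by
  set K := 1 / ProbabilityTheory.beta (1 + s) (1 + r) with hK
  have hK0 : 0 ≤ K := one_div_nonneg.2 (ProbabilityTheory.beta_pos (by positivity)
    (by positivity)).le
  have key : ∀ y : ℝ, 0 ≤ y → y ≤ 1 → (betaMeasure (1 + s) (1 + r)).real (Set.Ioi y) =
      K * ∫ x in y..1, x ^ s * (1 - x) ^ r := by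
    intro y h0 h1
    rw [Measure.real, betaMeasure_Ioi_eq_lintegral s r h0, ← hK,
      ← intervalIntegral.integral_const_mul, intervalIntegral.integral_of_le h1,
      integral_Ioc_eq_integral_Ioo, integral_eq_lintegral_of_nonneg_ae]
    · refine ae_restrict_of_forall_mem measurableSet_Ioo fun x hx => ?_
      have : 0 ≤ x := h0.trans hx.1.le
      have : 0 ≤ 1 - x := by linarith [hx.2]
      simp only [Pi.zero_apply]; positivity
    · exact (Continuous.measurable (by fun_prop)).aestronglyMeasurable
  have ht : (betaMeasure (1 + s) (1 + r)).real (Set.Ioi 0) = 1 := by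
    rw [← Set.compl_Iic, probReal_compl_eq_one_sub measurableSet_Iic, Measure.real,
      betaMeasure_Iic_zero]
    simp
  have e0 := integral_pow_mul_one_sub_pow s r 0
  have e1 : binomCDF (s + r + 1) 0 s = 1 := by
    rw [binomCDF, Finset.sum_range_succ']
    simp [binomWeight]
  rw [key 0 le_rfl zero_le_one] at ht
  rw [e1] at e0
  have hI : (∫ x in (0 : ℝ)..1, x ^ s * (1 - x) ^ r) ≠ 0 := by
    intro h; rw [h] at ht; simp at ht
  have hKc : K = (s + r + 1) * (s + r).choose s := mul_right_cancel₀ hI (ht.trans e0.symm)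
  rw [key y h0 h1, hKc, integral_pow_mul_one_sub_pow]

lemma betaMeasure_Iio_le (s r : ℕ) {y : ℝ} (h0 : 0 ≤ y) (h1 : y ≤ 1) :
    (betaMeasure (1 + s) (1 + r)).real (Set.Iio y) ≤ 1 - binomCDF (s + r + 1) y s := by
  rw [← betaMeasure_Ioi s r h0 h1, ← probReal_compl_eq_one_sub measurableSet_Ioi, Set.compl_Ioi]
  exact measureReal_mono Set.Iio_subset_Iic_self

/-! ### Sums along the path of success and failure counts -/

/-- The expected sum of `f` over the first `r` states of the pair of success and failure counts of
a sequence of Bernoulli trials with mean `u`, started at `(a, b)`. -/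
noncomputable def pathSum (u : ℝ) (f : ℕ → ℕ → ℝ) (r a b : ℕ) : ℝ :=
  ∑ n ∈ Finset.range r, binomMean u n fun s t => f (a + s) (b + t)

lemma pathSum_zero (u : ℝ) (f : ℕ → ℕ → ℝ) (a b : ℕ) : pathSum u f 0 a b = 0 := by
  simp [pathSum]

lemma pathSum_succ (u : ℝ) (f : ℕ → ℕ → ℝ) (r a b : ℕ) :
    pathSum u f (r + 1) a b =
      f a b + (u * pathSum u f r (a + 1) b + (1 - u) * pathSum u f r a (b + 1)) := by
  rw [pathSum, Finset.sum_range_succ', pathSum, pathSum, Finset.mul_sum, Finset.mul_sum,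
    ← Finset.sum_add_distrib, add_comm]
  congr 1
  · simp [binomMean, binomWeight]
  · refine Finset.sum_congr rfl fun n _ => ?_
    rw [binomMean_succ]
    simp only [add_assoc, add_comm 1]

lemma pathSum_mono {u : ℝ} (h0 : 0 ≤ u) (h1 : u ≤ 1) {f : ℕ → ℕ → ℝ} (hf : ∀ s r, 0 ≤ f s r)
    {r r' : ℕ} (h : r ≤ r') (a b : ℕ) : pathSum u f r a b ≤ pathSum u f r' a b :=
  Finset.sum_le_sum_of_subset_of_nonneg (Finset.range_mono h)
    fun _ _ _ => binomMean_nonneg h0 h1 fun _ _ => hf _ _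

lemma pathSum_add (u : ℝ) (f g : ℕ → ℕ → ℝ) (r a b : ℕ) :
    pathSum u (fun s t => f s t + g s t) r a b = pathSum u f r a b + pathSum u g r a b := by
  simp only [pathSum, binomMean, mul_add, Finset.sum_add_distrib]

lemma sum_range_ite_lt_le (T : ℕ) {z c : ℝ} (hz : 0 ≤ z) (hc : 0 ≤ c) :
    ∑ n ∈ Finset.range T, (if (n : ℝ) < z then c else 0) ≤ (z + 1) * c := by
  rw [← Finset.sum_filter, Finset.sum_const, nsmul_eq_mul]
  refine mul_le_mul_of_nonneg_right ?_ hc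
  have : (Finset.range T).filter (fun n : ℕ => (n : ℝ) < z) ⊆ Finset.range ⌈z⌉₊ := by
    intro n hn
    rw [Finset.mem_range]
    exact Nat.lt_ceil.2 (Finset.mem_filter.1 hn).2
  have h := Finset.card_le_card this
  rw [Finset.card_range] at h
  exact (Nat.cast_le.2 h).trans (Nat.ceil_lt_add_one hz).le

/-! ### The cost of underestimation -/

/-- The probability that a sample from the posterior after `s` successes and `r` failures exceeds
`y`. -/
noncomputable def upperTail (y : ℝ) (s r : ℕ) : ℝ := binomCDF (s + r + 1) y s

lemma upperTail_nonneg {y : ℝ} (h0 : 0 ≤ y) (h1 : y ≤ 1) (s r : ℕ) : 0 ≤ upperTail y s r :=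
  binomCDF_nonneg h0 h1 _ _

lemma upperTail_le_one {y : ℝ} (h0 : 0 ≤ y) (h1 : y ≤ 1) (s r : ℕ) : upperTail y s r ≤ 1 :=
  binomCDF_le_one h0 h1 (by omega)

/-- The factor between the probability that the sample lies below `y` and the probability that the
arm is pulled, regularized by `δ`. -/
noncomputable def missRatio (δ y : ℝ) (s r : ℕ) : ℝ := (1 - upperTail y s r) / (upperTail y s r + δ)

/-- The error made by the regularization in `missRatio`. -/
noncomputable def missError (δ y : ℝ) (s r : ℕ) : ℝ := δ / (upperTail y s r + δ)

lemma missRatio_nonneg {δ y : ℝ} (hδ : 0 < δ) (h0 : 0 ≤ y) (h1 : y ≤ 1) (s r : ℕ) :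
    0 ≤ missRatio δ y s r :=
  div_nonneg (by linarith [upperTail_le_one h0 h1 s r])
    (by linarith [upperTail_nonneg h0 h1 s r])

lemma missError_nonneg {δ y : ℝ} (hδ : 0 < δ) (h0 : 0 ≤ y) (h1 : y ≤ 1) (s r : ℕ) :
    0 ≤ missError δ y s r :=
  div_nonneg hδ.le (by linarith [upperTail_nonneg h0 h1 s r])

/-- The posterior probability of exceeding a level `y ≤ u` is at least `1 - y` times the
distribution function of the number of successes, so the logarithmic bound for the latter applies. -/
lemma binomMean_inv_upperTail_le {u y δ : ℝ} (h0 : 0 ≤ y) (hy : y < 1) (hyu : y ≤ u) (h1 : u ≤ 1)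
    (hδ : 0 < δ) (n : ℕ) :
    binomMean u n (fun s r => 1 / (upperTail y s r + δ)) ≤ Real.log ((1 + δ) / δ) / (1 - y) := by
  have hq : 0 < 1 - y := by linarith
  have hu0 := h0.trans hyu
  calc binomMean u n (fun s r => 1 / (upperTail y s r + δ))
      ≤ binomMean u n (fun s _ => (1 / (1 - y)) * (1 / (binomCDF n u s + δ))) := by
        refine binomMean_mono hu0 h1 fun s r hsr => ?_
        have e1 := one_sub_mul_binomCDF_le h0 hy.le (show s ≤ n by omega)
        have e2 := binomCDF_anti h0 hyu h1 (show s ≤ n by omega)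
        have e3 := binomCDF_nonneg hu0 h1 n s
        simp only [upperTail, hsr, one_div, ← mul_inv]
        apply inv_anti₀
        · exact mul_pos hq (by linarith)
        · nlinarith
    _ = (1 / (1 - y)) * ∑ k ∈ Finset.range (n + 1), binomWeight n u k / (binomCDF n u k + δ) := by
        rw [binomMean_const_mul]
        simp only [binomMean, mul_one_div]
    _ ≤ (1 / (1 - y)) * Real.log ((1 + δ) / δ) :=
        mul_le_mul_of_nonneg_left (sum_binomWeight_div_le hu0 h1 hδ n) (by positivity)
    _ = _ := by ring

lemma binomMean_lowerTail_le {u x : ℝ} (h1 : u ≤ 1) (hx : 0 < x) (n : ℕ) :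
    binomMean u n (fun s r => 1 - upperTail (max (u - x) 0) s r) ≤
      Real.exp (-(n * (x ^ 2 / (8 * (1 - max (u - x) 0))))) := by
  rcases le_total 0 (u - x) with h | h
  · rw [max_eq_left h]
    refine le_trans (le_of_eq ?_) (binomMean_one_sub_binomCDF_le h hx h1 n)
    refine Finset.sum_congr rfl fun k hk => ?_
    have : k + (n - k) = n := by have := Finset.mem_range.1 hk; omega
    simp only [upperTail, this]
  · rw [max_eq_right h]
    refine le_trans ?_ (Real.exp_pos _).le
    have : (fun s r => 1 - upperTail 0 s r) = fun _ _ => 0 := by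
      funext s r
      rw [upperTail, binomCDF, Finset.sum_range_succ']
      simp [binomWeight]
    rw [this, binomMean_const]

lemma half_le_log {T : ℕ} (hT : 1 < T) : 1 / 2 ≤ Real.log T := by
  have h2 : (2 : ℝ) ≤ T := by exact_mod_cast hT
  have := Real.log_le_log (by norm_num) h2
  have := Real.log_two_gt_d9
  linarith

lemma exp_neg_mul_log {T : ℕ} (hT : 1 < T) (n : ℕ) :
    Real.exp (-(n * Real.log T)) = ((T : ℝ) ^ n)⁻¹ := by
  rw [Real.exp_neg, Real.exp_nat_mul, Real.exp_log (by positivity)]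

/-- The total cost of underestimation of an arm at level `x` is of order `log T ^ 2 / x ^ 2`. The
posterior is concentrated up to `x` after about `q * log T / x ^ 2` pulls, `q = 1 - (u - x)`, and
before that every pull costs at most about `log T / q`, so that `q` cancels. -/
lemma pathSum_missRatio_le {T : ℕ} (hT : 1 < T) {u x : ℝ} (h0 : 0 ≤ u) (h1 : u ≤ 1)
    (hx : 0 < x) (hx1 : x ≤ 1 / 2) :
    pathSum u (missRatio ((T : ℝ) ^ 4)⁻¹ (max (u - x) 0)) T 0 0 +
      T * pathSum u (missError ((T : ℝ) ^ 4)⁻¹ (max (u - x) 0)) T 0 0 ≤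
      224 * Real.log T ^ 2 / x ^ 2 := by
  have hT2 : (2 : ℝ) ≤ T := by exact_mod_cast hT
  have hl := half_le_log hT
  set ell := Real.log T with hell
  set δ : ℝ := ((T : ℝ) ^ 4)⁻¹ with hδd
  have hδ : 0 < δ := by positivity
  set y := max (u - x) 0 with hy
  have hy0 : 0 ≤ y := le_max_right _ _
  have hyu : y ≤ u := max_le (by linarith) h0
  have hyx : x ≤ 1 - y := by
    have : y ≤ 1 - x := max_le (by linarith) (by linarith)
    linarith
  set q := 1 - y with hq
  have hq0 : 0 < q := hx.trans_le hyx
  have hy1 : y < 1 := by linarith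
  set Λ := Real.log ((1 + δ) / δ) with hΛ
  have hΛ5 : Λ ≤ 5 * ell := by
    have e : (1 + δ) / δ = T ^ 4 + 1 := by rw [hδd]; field_simp
    have e2 : (5 : ℝ) * ell = Real.log ((T : ℝ) ^ 5) := by rw [Real.log_pow, hell]; norm_num
    rw [hΛ, e, e2]
    apply Real.log_le_log (by positivity)
    have : (1 : ℝ) ≤ T ^ 4 := one_le_pow₀ (by linarith)
    nlinarith
  have hΛ0 : 0 ≤ Λ := by
    apply Real.log_nonneg
    rw [le_div_iff₀ hδ]; linarith
  have hinv := binomMean_inv_upperTail_le hy0 hy1 hyu h1 hδ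
  rw [← hΛ, ← hq] at hinv
  -- after `n0` trials the Chernoff bound is at most `T⁻⁵`, which beats the factor `δ⁻¹ = T ^ 4`
  set n0 := 40 * q * ell / x ^ 2 with hn0
  have hmiss : ∀ n, binomMean u n (missRatio δ y) ≤
      (if (n : ℝ) < n0 then Λ / q else 0) + (T : ℝ)⁻¹ := by
    intro n
    split_ifs with hn
    · refine le_trans (le_trans (binomMean_mono h0 h1 fun s r _ => ?_) (hinv n)) ?_
      · have := upperTail_nonneg hy0 hy1.le s r
        exact div_le_div_of_nonneg_right (by linarith) (by linarith)
      · have : (0 : ℝ) ≤ (T : ℝ)⁻¹ := by positivity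
        linarith
    · rw [zero_add]
      calc binomMean u n (missRatio δ y)
          ≤ binomMean u n (fun s r => δ⁻¹ * (1 - upperTail y s r)) := by
            refine binomMean_mono h0 h1 fun s r _ => ?_
            have := upperTail_nonneg hy0 hy1.le s r
            have := upperTail_le_one hy0 hy1.le s r
            rw [missRatio, div_eq_inv_mul]
            refine mul_le_mul_of_nonneg_right (inv_anti₀ hδ (by linarith)) (by linarith)
        _ ≤ δ⁻¹ * Real.exp (-((5 : ℕ) * ell)) := by
            rw [binomMean_const_mul]
            refine mul_le_mul_of_nonneg_left
              ((binomMean_lowerTail_le h1 hx n).trans ?_) (by positivity)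
            apply Real.exp_le_exp.2
            rw [neg_le_neg_iff]
            have hn' : n0 ≤ n := not_lt.1 hn
            calc ((5 : ℕ) : ℝ) * ell = n0 * (x ^ 2 / (8 * q)) := by
                  rw [hn0]; field_simp; norm_num
              _ ≤ _ := mul_le_mul_of_nonneg_right hn' (by positivity)
        _ = (T : ℝ)⁻¹ := by
            rw [hell, exp_neg_mul_log hT, hδd]; field_simp
  have hT0 : (0 : ℝ) < T := by linarith
  have hS1 : pathSum u (missRatio δ y) T 0 0 ≤ (n0 + 1) * (Λ / q) + 1 := by
    simp only [pathSum, Nat.zero_add]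
    calc _ ≤ ∑ n ∈ Finset.range T, ((if (n : ℝ) < n0 then Λ / q else 0) + (T : ℝ)⁻¹) :=
          Finset.sum_le_sum fun n _ => hmiss n
      _ ≤ _ := by
          rw [Finset.sum_add_distrib, Finset.sum_const, Finset.card_range, nsmul_eq_mul,
            mul_inv_cancel₀ hT0.ne']
          have := sum_range_ite_lt_le T (z := n0) (c := Λ / q) (by positivity) (by positivity)
          linarith
  have hS2 : pathSum u (missError δ y) T 0 0 ≤ T * (δ * (Λ / q)) := by
    simp only [pathSum, Nat.zero_add]
    calc _ ≤ ∑ n ∈ Finset.range T, δ * (Λ / q) := Finset.sum_le_sum fun n _ => by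
          have e : missError δ y = fun s r => δ * (1 / (upperTail y s r + δ)) := by
            funext s r; rw [missError]; ring
          change binomMean u n (missError δ y) ≤ _
          rw [e, binomMean_const_mul]
          exact mul_le_mul_of_nonneg_left (hinv n) hδ.le
      _ = _ := by simp
  have hTδ : (T : ℝ) * (T * δ) ≤ 1 := by
    have e : (T : ℝ) * (T * δ) = ((T : ℝ) ^ 2)⁻¹ := by rw [hδd]; field_simp
    rw [e]
    exact inv_le_one_of_one_le₀ (one_le_pow₀ (by linarith))
  have hΛq : Λ / q ≤ 5 * ell / x := div_le_div₀ (by linarith) hΛ5 hx hyx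
  have hΛq0 : 0 ≤ Λ / q := by positivity
  have h1' : n0 * (Λ / q) ≤ 200 * ell ^ 2 / x ^ 2 := by
    -- the factor `q` cancels here
    have e : n0 * (Λ / q) = 40 * ell * Λ / x ^ 2 := by rw [hn0]; field_simp
    rw [e]
    apply div_le_div_of_nonneg_right _ (by positivity)
    nlinarith
  have h2' : T * (T * (δ * (Λ / q))) ≤ Λ / q := by
    have := mul_le_mul_of_nonneg_right hTδ hΛq0
    linarith
  have h3' : T * pathSum u (missError δ y) T 0 0 ≤ Λ / q :=
    (mul_le_mul_of_nonneg_left hS2 hT0.le).trans h2'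
  have h4 : 5 * ell / x ≤ 10 * ell ^ 2 / x ^ 2 := by
    rw [div_le_div_iff₀ hx (by positivity)]
    have : 5 * ell * x ≤ 10 * ell ^ 2 := by nlinarith
    nlinarith
  have h5 : 1 ≤ 4 * ell ^ 2 / x ^ 2 := by
    rw [le_div_iff₀ (by positivity)]; nlinarith
  have : (224 : ℝ) * ell ^ 2 / x ^ 2 = 200 * ell ^ 2 / x ^ 2 + 10 * ell ^ 2 / x ^ 2 +
    10 * ell ^ 2 / x ^ 2 + 4 * ell ^ 2 / x ^ 2 := by ring
  rw [this]
  linarith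

/-! ### The cost of overestimation -/

/-- Whether an arm has been pulled fewer than `z` times. -/
noncomputable def fewPulls (z : ℝ) (s r : ℕ) : ℝ := if (s : ℝ) + r < z then 1 else 0

/-- The upper tail of the posterior of an arm that has been pulled at least `z` times. -/
noncomputable def lateTail (z y : ℝ) (s r : ℕ) : ℝ := if (s : ℝ) + r < z then 0 else upperTail y s r

lemma fewPulls_nonneg (z : ℝ) (s r : ℕ) : 0 ≤ fewPulls z s r := by
  unfold fewPulls; split_ifs <;> norm_num

lemma lateTail_nonneg {z y : ℝ} (h0 : 0 ≤ y) (h1 : y ≤ 1) (s r : ℕ) : 0 ≤ lateTail z y s r := by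
  unfold lateTail; split_ifs
  · exact le_rfl
  · exact upperTail_nonneg h0 h1 s r

lemma binomMean_upperTail_le {u x : ℝ} (h0 : 0 ≤ u) (hx : 0 < x) (n : ℕ) :
    binomMean u n (upperTail (min (u + x) 1)) ≤ Real.exp (-(n * (x ^ 2 / 8))) := by
  rcases le_total (u + x) 1 with h | h
  · rw [min_eq_left h]
    refine le_trans (le_of_eq ?_) ((binomMean_binomCDF_le h0 hx h n).trans ?_)
    · refine Finset.sum_congr rfl fun k hk => ?_
      have : k + (n - k) = n := by have := Finset.mem_range.1 hk; omega
      simp only [upperTail, this]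
    · apply Real.exp_le_exp.2
      have : x ^ 2 / 8 ≤ x ^ 2 / (8 * (u + x)) := by
        apply div_le_div_of_nonneg_left (by positivity) (by positivity); linarith
      have := mul_le_mul_of_nonneg_left this (Nat.cast_nonneg (α := ℝ) n)
      linarith
  · rw [min_eq_right h]
    refine le_trans ?_ (Real.exp_pos _).le
    have : upperTail 1 = fun _ _ => 0 := by
      funext s r
      rw [upperTail, binomCDF]
      refine Finset.sum_eq_zero fun k hk => ?_
      have : s + r + 1 - k ≠ 0 := by have := Finset.mem_range.1 hk; omega
      simp [binomWeight, this]
    rw [this, binomMean_const]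

lemma pathSum_fewPulls_le {T : ℕ} (hT : 1 < T) {u x : ℝ} (h0 : 0 ≤ u) (hx : 0 < x)
    (hx1 : x ≤ 1 / 2) :
    pathSum u (fewPulls (16 * Real.log T / x ^ 2)) T 0 0 +
      T * pathSum u (lateTail (16 * Real.log T / x ^ 2) (min (u + x) 1)) T 0 0 ≤
      40 * Real.log T ^ 2 / x ^ 2 := by
  have hT2 : (2 : ℝ) ≤ T := by exact_mod_cast hT
  have hl := half_le_log hT
  have hT0 : (0 : ℝ) < T := by linarith
  set ell := Real.log T with hell
  set z := 16 * ell / x ^ 2 with hz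
  have hz0 : 0 ≤ z := by positivity
  have hsum : ∀ {n k : ℕ}, k ∈ Finset.range (n + 1) → (k : ℝ) + (n - k : ℕ) = n := by
    intro n k hk
    have : k + (n - k) = n := by have := Finset.mem_range.1 hk; omega
    exact_mod_cast this
  have hS1 : pathSum u (fewPulls z) T 0 0 ≤ z + 1 := by
    have h := sum_range_ite_lt_le T hz0 zero_le_one
    rw [mul_one] at h
    refine le_trans (le_of_eq ?_) h
    simp only [pathSum, Nat.zero_add]
    refine Finset.sum_congr rfl fun n _ => ?_
    rw [← binomMean_const u n (if (n : ℝ) < z then 1 else 0)]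
    refine Finset.sum_congr rfl fun k hk => ?_
    simp only [fewPulls, hsum hk]
  -- after `z` trials the Chernoff bound is at most `T⁻²`
  have hS2 : pathSum u (lateTail z (min (u + x) 1)) T 0 0 ≤ (T : ℝ) * ((T : ℝ) ^ 2)⁻¹ := by
    simp only [pathSum, Nat.zero_add]
    calc _ ≤ ∑ n ∈ Finset.range T, ((T : ℝ) ^ 2)⁻¹ := Finset.sum_le_sum fun n _ => ?_
      _ = _ := by simp
    by_cases hn : (n : ℝ) < z
    · have : binomMean u n (fun s t => lateTail z (min (u + x) 1) s t) = 0 := by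
        refine Finset.sum_eq_zero fun k hk => ?_
        simp only [lateTail, hsum hk, if_pos hn, mul_zero]
      rw [this]; positivity
    · have : binomMean u n (fun s t => lateTail z (min (u + x) 1) s t) =
          binomMean u n (upperTail (min (u + x) 1)) := by
        refine Finset.sum_congr rfl fun k hk => ?_
        simp only [lateTail, hsum hk, if_neg hn]
      rw [this, ← exp_neg_mul_log hT]
      refine (binomMean_upperTail_le h0 hx n).trans (Real.exp_le_exp.2 ?_)
      rw [neg_le_neg_iff]
      calc ((2 : ℕ) : ℝ) * Real.log T = z * (x ^ 2 / 8) := by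
            rw [hz, hell]; field_simp; ring
        _ ≤ _ := mul_le_mul_of_nonneg_right (not_lt.1 hn) (by positivity)
  have hS3 : T * pathSum u (lateTail z (min (u + x) 1)) T 0 0 ≤ 1 := by
    have := mul_le_mul_of_nonneg_left hS2 hT0.le
    have e : (T : ℝ) * (T * ((T : ℝ) ^ 2)⁻¹) = 1 := by field_simp
    linarith
  have h4 : z ≤ 32 * ell ^ 2 / x ^ 2 := by
    rw [hz]
    apply div_le_div_of_nonneg_right _ (by positivity)
    nlinarith
  have h5 : 2 ≤ 8 * ell ^ 2 / x ^ 2 := by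
    rw [le_div_iff₀ (by positivity)]; nlinarith
  have : (40 : ℝ) * ell ^ 2 / x ^ 2 = 32 * ell ^ 2 / x ^ 2 + 8 * ell ^ 2 / x ^ 2 := by ring
  rw [this]
  linarith

variable {N : ℕ}

/-! ### Maximizers of the objective for fixed samples -/

lemma mem_actions {m : ℕ} {S A : Finset (Fin N)} : A ∈ actions m S ↔ A ⊆ S ∧ A.card ≤ m := by
  simp [actions]

/-- A set of at most `m` elements of `S` with the largest total score consists of the elements
above a threshold. -/
lemma exists_threshold {m : ℕ} (hm : 0 < m) {S A : Finset (Fin N)} {s : Fin N → ℝ}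
    (hs : ∀ i, 0 ≤ s i) (hA : A ∈ actions m S)
    (hmax : ∀ A' ∈ actions m S, ∑ i ∈ A', s i ≤ ∑ i ∈ A, s i) :
    ∃ τ, 0 ≤ τ ∧ (∀ j ∈ A, τ ≤ s j) ∧ (∀ i ∈ S, i ∉ A → s i ≤ τ) ∧
      (S.filter fun j => τ < s j).card < m ∧ (A.card = m ∨ τ = 0) := by
  obtain ⟨hAS, hAm⟩ := mem_actions.1 hA
  rcases hAm.lt_or_eq with hlt | heq
  · have hout : ∀ i ∈ S, i ∉ A → s i ≤ 0 := by
      intro i hi hiA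
      have h := hmax (insert i A) (mem_actions.2 ⟨Finset.insert_subset hi hAS, by
        rw [Finset.card_insert_of_notMem hiA]; omega⟩)
      rw [Finset.sum_insert hiA] at h
      linarith
    refine ⟨0, le_rfl, fun j _ => hs j, hout, lt_of_le_of_lt (Finset.card_le_card ?_) hlt,
      Or.inr rfl⟩
    intro j hj
    obtain ⟨hjS, hj0⟩ := Finset.mem_filter.1 hj
    by_contra hjA
    exact absurd (hout j hjS hjA) (not_le.2 hj0)
  · obtain ⟨j, hjA, hj⟩ := Finset.exists_min_image A s (Finset.card_pos.1 (by omega))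
    have hout : ∀ i ∈ S, i ∉ A → s i ≤ s j := by
      intro i hi hiA
      have hi' : i ∉ A.erase j := fun h => hiA (Finset.mem_of_mem_erase h)
      have h := hmax (insert i (A.erase j)) (mem_actions.2
        ⟨Finset.insert_subset hi ((Finset.erase_subset _ _).trans hAS), by
          rw [Finset.card_insert_of_notMem hi', Finset.card_erase_of_mem hjA]; omega⟩)
      rw [Finset.sum_insert hi', ← Finset.add_sum_erase A s hjA] at h
      linarith
    refine ⟨s j, hs j, hj, hout, ?_, Or.inl heq⟩
    have : S.filter (fun i => s j < s i) ⊆ A.erase j := by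
      intro i hi
      obtain ⟨hiS, hij⟩ := Finset.mem_filter.1 hi
      refine Finset.mem_erase.2 ⟨fun h => by subst h; exact lt_irrefl _ hij, ?_⟩
      by_contra hiA
      exact absurd (hout i hiS hiA) (not_le.2 hij)
    have h := Finset.card_le_card this
    rw [Finset.card_erase_of_mem hjA] at h
    omega

/-- The samples for which fewer than `m` available arms other than `i` reach the score that arm
`i` has for the sample value `y`. The sample of arm `i` itself does not matter. -/
def openSlot (b w : Fin N → ℝ) (m : ℕ) (S : Finset (Fin N)) (i : Fin N) (y : ℝ) :
    Set (Fin N → ℝ) :=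
  {θ | 0 < w i ∧ ((S.erase i).filter fun j => b i + w i * y ≤ b j + w j * θ j).card < m}

/-- In an open slot the arm is pulled as soon as its own sample exceeds the level. -/
lemma mem_of_openSlot {b w : Fin N → ℝ} {m : ℕ} {S A : Finset (Fin N)} {i : Fin N} {y : ℝ}
    {θ : Fin N → ℝ} (hm : 0 < m) (hs : ∀ j, 0 ≤ b j + w j * θ j) (hb : 0 ≤ b i) (hy : 0 ≤ y)
    (hi : i ∈ S) (hA : A ∈ actions m S)
    (hmax : ∀ A' ∈ actions m S, ∑ j ∈ A', (b j + w j * θ j) ≤ ∑ j ∈ A, (b j + w j * θ j))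
    (hslot : θ ∈ openSlot b w m S i y) (hθ : y < θ i) : i ∈ A := by
  obtain ⟨hw, hcard⟩ := hslot
  obtain ⟨τ, -, hin, hout, -, hor⟩ := exists_threshold hm hs hA hmax
  by_contra hiA
  have hlt : b i + w i * y < b i + w i * θ i := by gcongr
  have hτ := hout i hi hiA
  rcases hor with hc | h0
  · have : A ⊆ (S.erase i).filter fun j => b i + w i * y ≤ b j + w j * θ j := by
      intro j hj
      refine Finset.mem_filter.2 ⟨Finset.mem_erase.2 ⟨fun h => hiA (h ▸ hj),
        (mem_actions.1 hA).1 hj⟩, ?_⟩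
      linarith [hin j hj]
    have := Finset.card_le_card this
    omega
  · have : 0 ≤ w i * y := by positivity
    linarith

/-- A dyadic upper bound of a number in terms of its comparisons with the levels `2⁻ᵏ`. -/
lemma le_sum_dyadic {z : ℝ} (hz : z ≤ 1) (L : ℕ) :
    z ≤ (1 / 2) ^ L + ∑ k ∈ Finset.range L,
      (1 / 2 : ℝ) ^ (k + 1) * (if (1 / 2 : ℝ) ^ (k + 1) < z then 1 else 0) := by
  induction L with
  | zero => simpa using hz
  | succ L ih =>
    have h0 : 0 ≤ ∑ k ∈ Finset.range L,
      (1 / 2 : ℝ) ^ (k + 1) * (if (1 / 2 : ℝ) ^ (k + 1) < z then 1 else 0) :=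
      Finset.sum_nonneg fun k _ => by split_ifs <;> positivity
    rw [Finset.sum_range_succ]
    split_ifs with h
    · rw [pow_succ (1 / 2 : ℝ) L] at *
      linarith
    · linarith [not_lt.1 h]

/-- For fixed samples, the loss of the pulled set `A` against any admissible set `Aopt`, measured
with the true means, is due to arms outside `A` whose samples are too low and to arms in `A` whose
samples are too high. In the first case the slot of the arm is open. -/
lemma sum_sub_sum_le {b w u θ : Fin N → ℝ} {m : ℕ} {S A Aopt : Finset (Fin N)} {W : ℝ}
    (hm : 0 < m) (hb : ∀ i, 0 ≤ b i) (hw : ∀ i, 0 ≤ w i) (hW : ∀ i, w i ≤ W) (hW0 : 0 ≤ W)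
    (hu0 : ∀ i, 0 ≤ u i) (hu1 : ∀ i, u i ≤ 1) (hθ0 : ∀ i, 0 ≤ θ i) (hθ1 : ∀ i, θ i ≤ 1)
    (hAopt : Aopt ∈ actions m S) (hA : A ∈ actions m S)
    (hmax : ∀ A' ∈ actions m S, ∑ j ∈ A', (b j + w j * θ j) ≤ ∑ j ∈ A, (b j + w j * θ j))
    (L : ℕ) :
    ∑ i ∈ Aopt, (b i + w i * u i) - ∑ i ∈ A, (b i + w i * u i) ≤
      W * (2 * m * (1 / 2) ^ L + ∑ k ∈ Finset.range L, (1 / 2 : ℝ) ^ (k + 1) *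
        (∑ i ∈ S, (openSlot b w m S i (max (u i - (1 / 2) ^ (k + 1)) 0) ∩
            {θ | θ i < max (u i - (1 / 2) ^ (k + 1)) 0}).indicator 1 θ +
          ∑ i ∈ A, {θ : Fin N → ℝ | min (u i + (1 / 2) ^ (k + 1)) 1 < θ i}.indicator 1 θ)) := by
  have hs : ∀ j, 0 ≤ b j + w j * θ j := fun j =>
    add_nonneg (hb j) (mul_nonneg (hw j) (hθ0 j))
  obtain ⟨τ, hτ0, hin, hout, hcard, hor⟩ := exists_threshold hm hs hA hmax
  set low : ℕ → Fin N → ℝ := fun k i =>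
    (openSlot b w m S i (max (u i - (1 / 2) ^ (k + 1)) 0) ∩
      {θ | θ i < max (u i - (1 / 2) ^ (k + 1)) 0}).indicator 1 θ with hlow
  set high : ℕ → Fin N → ℝ := fun k i =>
    {θ : Fin N → ℝ | min (u i + (1 / 2) ^ (k + 1)) 1 < θ i}.indicator 1 θ with hhigh
  have hlow0 : ∀ k i, 0 ≤ low k i := fun k i => Set.indicator_nonneg (fun _ _ => zero_le_one) _
  have hhigh0 : ∀ k i, 0 ≤ high k i := fun k i => Set.indicator_nonneg (fun _ _ => zero_le_one) _
  obtain ⟨hAS, hAm⟩ := mem_actions.1 hA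
  obtain ⟨hOS, hOm⟩ := mem_actions.1 hAopt
  have hD : ∀ i ∈ Aopt \ A, b i + w i * u i ≤ τ +
      W * ((1 / 2) ^ L + ∑ k ∈ Finset.range L, (1 / 2 : ℝ) ^ (k + 1) * low k i) := by
    intro i hi
    obtain ⟨hiO, hiA⟩ := Finset.mem_sdiff.1 hi
    have hτi := hout i (hOS hiO) hiA
    have hr : 0 ≤ (1 / 2 : ℝ) ^ L + ∑ k ∈ Finset.range L, (1 / 2 : ℝ) ^ (k + 1) * low k i :=
      add_nonneg (by positivity)
        (Finset.sum_nonneg fun k _ => mul_nonneg (by positivity) (hlow0 k i))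
    rcases (hw i).eq_or_lt with h0 | hpos
    · rw [← h0] at hτi ⊢
      have := mul_nonneg hW0 hr
      linarith
    · have hz : (b i + w i * u i - τ) / w i ≤ 1 := by
        rw [div_le_one hpos]
        have h1 := mul_le_mul_of_nonneg_left (hu1 i) (hw i)
        have h2 := mul_nonneg (hw i) (hθ0 i)
        linarith
      have h := le_sum_dyadic hz L
      have h' : (b i + w i * u i - τ) / w i ≤
          (1 / 2 : ℝ) ^ L + ∑ k ∈ Finset.range L, (1 / 2 : ℝ) ^ (k + 1) * low k i := by
        refine h.trans (add_le_add_right (Finset.sum_le_sum fun k _ => ?_) _)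
        refine mul_le_mul_of_nonneg_left ?_ (by positivity)
        split_ifs with hk
        · rw [lt_div_iff₀ hpos] at hk
          have hmax1 : u i - (1 / 2) ^ (k + 1) ≤ max (u i - (1 / 2) ^ (k + 1)) 0 :=
            le_max_left _ _
          have hτlt : τ < b i + w i * max (u i - (1 / 2) ^ (k + 1)) 0 := by
            have := mul_le_mul_of_nonneg_left hmax1 (hw i)
            linarith
          have hmem : θ ∈ openSlot b w m S i (max (u i - (1 / 2) ^ (k + 1)) 0) ∩
              {θ | θ i < max (u i - (1 / 2) ^ (k + 1)) 0} := by
            refine ⟨⟨hpos, lt_of_le_of_lt (Finset.card_le_card ?_) hcard⟩, ?_⟩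
            · intro j hj
              obtain ⟨hj1, hj2⟩ := Finset.mem_filter.1 hj
              exact Finset.mem_filter.2 ⟨Finset.mem_of_mem_erase hj1, hτlt.trans_le hj2⟩
            · have : w i * θ i < w i * max (u i - (1 / 2) ^ (k + 1)) 0 := by linarith
              exact lt_of_mul_lt_mul_left this (hw i)
          rw [hlow]
          simp only [Set.indicator_of_mem hmem, Pi.one_apply, le_refl]
        · exact hlow0 k i
      rw [div_le_iff₀ hpos] at h'
      have := mul_le_mul_of_nonneg_left (hW i) hr
      linarith
  have hE : ∀ j ∈ A, b j + w j * θ j ≤ b j + w j * u j +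
      W * ((1 / 2) ^ L + ∑ k ∈ Finset.range L, (1 / 2 : ℝ) ^ (k + 1) * high k j) := by
    intro j _
    have hr : 0 ≤ (1 / 2 : ℝ) ^ L + ∑ k ∈ Finset.range L, (1 / 2 : ℝ) ^ (k + 1) * high k j :=
      add_nonneg (by positivity)
        (Finset.sum_nonneg fun k _ => mul_nonneg (by positivity) (hhigh0 k j))
    have h := le_sum_dyadic (z := θ j - u j) (by linarith [hθ1 j, hu0 j]) L
    have h' : θ j - u j ≤
        (1 / 2 : ℝ) ^ L + ∑ k ∈ Finset.range L, (1 / 2 : ℝ) ^ (k + 1) * high k j := by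
      refine h.trans (add_le_add_right (Finset.sum_le_sum fun k _ => ?_) _)
      refine mul_le_mul_of_nonneg_left ?_ (by positivity)
      split_ifs with hk
      · have hmem : θ ∈ {θ : Fin N → ℝ | min (u j + (1 / 2) ^ (k + 1)) 1 < θ j} := by
          have := min_le_left (u j + (1 / 2 : ℝ) ^ (k + 1)) 1
          exact this.trans_lt (by linarith)
        rw [hhigh]
        simp only [Set.indicator_of_mem hmem, Pi.one_apply, le_refl]
      · exact hhigh0 k j
    have h1 := mul_le_mul_of_nonneg_left h' (hw j)
    have h2 := mul_le_mul_of_nonneg_right (hW j) hr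
    linarith
  have hDsum := Finset.sum_le_sum hD
  have hEsum := Finset.sum_le_sum fun j (hj : j ∈ A \ Aopt) => hE j (Finset.mem_sdiff.1 hj).1
  simp only [Finset.sum_add_distrib, Finset.sum_const, nsmul_eq_mul,
    ← Finset.mul_sum _ _ W] at hDsum hEsum
  -- exchanging the two differences costs nothing on the level of the threshold
  have hτsum : ((Aopt \ A).card : ℝ) * τ ≤ ∑ j ∈ A \ Aopt, (b j + w j * θ j) := by
    have h1 : ((A \ Aopt).card : ℝ) * τ ≤ ∑ j ∈ A \ Aopt, (b j + w j * θ j) := by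
      rw [← nsmul_eq_mul]
      exact Finset.card_nsmul_le_sum _ _ _ fun j hj => hin j (Finset.mem_sdiff.1 hj).1
    rcases hor with hc | h0
    · have e1 := Finset.card_sdiff_add_card_inter Aopt A
      have e2 := Finset.card_sdiff_add_card_inter A Aopt
      rw [Finset.inter_comm] at e2
      have : ((Aopt \ A).card : ℝ) ≤ (A \ Aopt).card := by
        have : (Aopt \ A).card ≤ (A \ Aopt).card := by omega
        exact_mod_cast this
      exact (mul_le_mul_of_nonneg_right this hτ0).trans h1
    · rw [h0, mul_zero] at h1 ⊢; exact h1
  have hcD : ((Aopt \ A).card : ℝ) ≤ m := by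
    exact_mod_cast (Finset.card_le_card Finset.sdiff_subset).trans hOm
  have hcE : ((A \ Aopt).card : ℝ) ≤ m := by
    exact_mod_cast (Finset.card_le_card Finset.sdiff_subset).trans hAm
  have hsD : ∑ i ∈ Aopt \ A, ∑ k ∈ Finset.range L, (1 / 2 : ℝ) ^ (k + 1) * low k i ≤
      ∑ k ∈ Finset.range L, (1 / 2 : ℝ) ^ (k + 1) * ∑ i ∈ S, low k i := by
    rw [Finset.sum_comm]
    refine Finset.sum_le_sum fun k _ => ?_
    rw [← Finset.mul_sum]
    refine mul_le_mul_of_nonneg_left ?_ (by positivity)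
    exact Finset.sum_le_sum_of_subset_of_nonneg (Finset.sdiff_subset.trans hOS)
      fun i _ _ => hlow0 k i
  have hsE : ∑ i ∈ A \ Aopt, ∑ k ∈ Finset.range L, (1 / 2 : ℝ) ^ (k + 1) * high k i ≤
      ∑ k ∈ Finset.range L, (1 / 2 : ℝ) ^ (k + 1) * ∑ i ∈ A, high k i := by
    rw [Finset.sum_comm]
    refine Finset.sum_le_sum fun k _ => ?_
    rw [← Finset.mul_sum]
    refine mul_le_mul_of_nonneg_left ?_ (by positivity)
    exact Finset.sum_le_sum_of_subset_of_nonneg Finset.sdiff_subset fun i _ _ => hhigh0 k i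
  have hsplit : ∑ i ∈ Aopt, (b i + w i * u i) - ∑ i ∈ A, (b i + w i * u i) =
      ∑ i ∈ Aopt \ A, (b i + w i * u i) - ∑ i ∈ A \ Aopt, (b i + w i * u i) := by
    rw [Finset.sum_sdiff_sub_sum_sdiff]
  rw [hsplit]
  simp only [mul_add, Finset.sum_add_distrib] at hDsum hEsum hτsum ⊢
  have p0 : (0 : ℝ) ≤ (1 / 2) ^ L := by positivity
  have q1 := mul_le_mul_of_nonneg_left hsD hW0
  have q2 := mul_le_mul_of_nonneg_left hsE hW0
  have q3 := mul_le_mul_of_nonneg_left (mul_le_mul_of_nonneg_right hcD p0) hW0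
  have q4 := mul_le_mul_of_nonneg_left (mul_le_mul_of_nonneg_right hcE p0) hW0
  linarith

/-! ### Expectations under distributions on finite types -/

section Expect

variable {α β : Type*} [Fintype α] [Fintype β]

/-- The expectation of a real function under a distribution on a finite type. -/
noncomputable def expect (p : PMF α) (f : α → ℝ) : ℝ := ∑ a, (p a).toReal * f a

lemma sum_toReal_eq_one (p : PMF α) : ∑ a, (p a).toReal = 1 := by
  rw [← ENNReal.toReal_sum fun a _ => p.apply_ne_top a, ← tsum_fintype (L := .unconditional _),
    p.tsum_coe, ENNReal.toReal_one]

lemma expect_const (p : PMF α) (c : ℝ) : expect p (fun _ => c) = c := by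
  rw [expect, ← Finset.sum_mul, sum_toReal_eq_one, one_mul]

lemma expect_mono_of_ne_zero {p : PMF α} {f g : α → ℝ} (h : ∀ a, p a ≠ 0 → f a ≤ g a) :
    expect p f ≤ expect p g := by
  refine Finset.sum_le_sum fun a _ => ?_
  by_cases ha : p a = 0
  · simp [ha]
  · exact mul_le_mul_of_nonneg_left (h a ha) ENNReal.toReal_nonneg

lemma expect_mono {p : PMF α} {f g : α → ℝ} (h : ∀ a, f a ≤ g a) : expect p f ≤ expect p g :=
  expect_mono_of_ne_zero fun a _ => h a

lemma expect_nonneg {p : PMF α} {f : α → ℝ} (h : ∀ a, 0 ≤ f a) : 0 ≤ expect p f :=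
  Finset.sum_nonneg fun a _ => mul_nonneg ENNReal.toReal_nonneg (h a)

lemma expect_add (p : PMF α) (f g : α → ℝ) :
    expect p (fun a => f a + g a) = expect p f + expect p g := by
  simp only [expect, mul_add, Finset.sum_add_distrib]

lemma expect_sub (p : PMF α) (f g : α → ℝ) :
    expect p (fun a => f a - g a) = expect p f - expect p g := by
  simp only [expect, mul_sub, Finset.sum_sub_distrib]

lemma expect_const_mul (p : PMF α) (c : ℝ) (f : α → ℝ) :
    expect p (fun a => c * f a) = c * expect p f := by
  simp only [expect, Finset.mul_sum]
  exact Finset.sum_congr rfl fun _ _ => by ring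

lemma expect_sum {ι : Type*} (p : PMF α) (s : Finset ι) (f : ι → α → ℝ) :
    expect p (fun a => ∑ i ∈ s, f i a) = ∑ i ∈ s, expect p (f i) := by
  simp only [expect, Finset.mul_sum]
  exact Finset.sum_comm

lemma expect_pure (a : α) (f : α → ℝ) : expect (PMF.pure a) f = f a := by
  classical
  rw [expect, Finset.sum_eq_single a]
  · simp
  · intro b _ hb; simp [PMF.pure_apply, hb]
  · simp

lemma expect_bind (p : PMF α) (q : α → PMF β) (f : β → ℝ) :
    expect (p.bind q) f = expect p fun a => expect (q a) f := by
  have h : ∀ b, ((p.bind q) b).toReal = ∑ a, (p a).toReal * (q a b).toReal := by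
    intro b
    rw [PMF.bind_apply, tsum_fintype, ENNReal.toReal_sum fun a _ =>
      ENNReal.mul_ne_top (p.apply_ne_top a) ((q a).apply_ne_top b)]
    simp only [ENNReal.toReal_mul]
  simp only [expect, h, Finset.sum_mul, Finset.mul_sum, mul_assoc]
  exact Finset.sum_comm

lemma expect_map (p : PMF α) (g : α → β) (f : β → ℝ) :
    expect (p.map g) f = expect p fun a => f (g a) := by
  rw [← PMF.bind_pure_comp, expect_bind]
  simp only [Function.comp, expect_pure]

end Expect

/-! ### One round, given the history -/

/-- The number of rewards `1` seen from arm `i`. -/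
def succCount {t : ℕ} (h : History N t) (i : Fin N) : ℕ :=
  ∑ s, if i ∈ (h s).pulled then (if (h s).reward i then 1 else 0) else 0

/-- The number of rewards `0` seen from arm `i`. -/
def failCount {t : ℕ} (h : History N t) (i : Fin N) : ℕ :=
  ∑ s, if i ∈ (h s).pulled then (if (h s).reward i then 0 else 1) else 0

lemma alpha_eq {t : ℕ} (h : History N t) (i : Fin N) : alpha h i = 1 + succCount h i := by
  rw [alpha, succCount, Nat.cast_sum]
  congr 1
  refine Finset.sum_congr rfl fun s _ => ?_
  unfold Round.X
  split_ifs <;> simp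

lemma beta_eq {t : ℕ} (h : History N t) (i : Fin N) : beta h i = 1 + failCount h i := by
  rw [beta, failCount, Nat.cast_sum]
  congr 1
  refine Finset.sum_congr rfl fun s _ => ?_
  unfold Round.X
  split_ifs <;> simp

lemma sampleLaw_eq {t : ℕ} (h : History N t) : sampleLaw h =
    Measure.pi fun i => betaMeasure (1 + succCount h i) (1 + failCount h i) := by
  simp only [sampleLaw, alpha_eq, beta_eq]

lemma sampleLaw_eval {t : ℕ} (h : History N t) (i : Fin N) {s : Set ℝ} (hs : MeasurableSet s) :
    sampleLaw h {θ | θ i ∈ s} = betaMeasure (1 + succCount h i) (1 + failCount h i) s := by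
  rw [sampleLaw_eq]
  exact (measurePreserving_eval
    (fun i => betaMeasure (1 + succCount h i) (1 + failCount h i)) i).measure_preimage
      hs.nullMeasurableSet

lemma sampleLaw_real_gt {t : ℕ} (h : History N t) (i : Fin N) {y : ℝ} (h0 : 0 ≤ y) (h1 : y ≤ 1) :
    (sampleLaw h).real {θ | y < θ i} = upperTail y (succCount h i) (failCount h i) := by
  rw [upperTail, ← betaMeasure_Ioi _ _ h0 h1, Measure.real, Measure.real,
    ← sampleLaw_eval h i measurableSet_Ioi]
  rfl

lemma sampleLaw_real_lt_le {t : ℕ} (h : History N t) (i : Fin N) {y : ℝ} (h0 : 0 ≤ y)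
    (h1 : y ≤ 1) :
    (sampleLaw h).real {θ | θ i < y} ≤ 1 - upperTail y (succCount h i) (failCount h i) := by
  refine le_trans (le_of_eq ?_) (betaMeasure_Iio_le _ _ h0 h1)
  rw [Measure.real, Measure.real, ← sampleLaw_eval h i measurableSet_Iio]
  rfl

lemma ae_mem_unit {t : ℕ} (h : History N t) :
    ∀ᵐ θ ∂(sampleLaw h), ∀ i, 0 ≤ θ i ∧ θ i ≤ 1 := by
  rw [ae_all_iff]
  intro i
  have h1 : sampleLaw h {θ | θ i ∈ Set.Iic 0} = 0 := by
    rw [sampleLaw_eval h i measurableSet_Iic, betaMeasure_Iic_zero]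
  have h2 : sampleLaw h {θ | θ i ∈ Set.Ici 1} = 0 := by
    rw [sampleLaw_eval h i measurableSet_Ici, betaMeasure_Ici_one]
  filter_upwards [measure_eq_zero_iff_ae_notMem.1 h1, measure_eq_zero_iff_ae_notMem.1 h2]
    with θ a b
  simp only [Set.mem_Iic, Set.mem_Ici, not_le] at a b
  exact ⟨a.le, b.le⟩

lemma measurableSet_openSlot (b w : Fin N → ℝ) (m : ℕ) (S : Finset (Fin N)) (i : Fin N) (y : ℝ) :
    MeasurableSet (openSlot b w m S i y) := by
  unfold openSlot
  refine MeasurableSet.const _ |>.inter ?_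
  have : Measurable fun θ : Fin N → ℝ =>
      ((S.erase i).filter fun j => b i + w i * y ≤ b j + w j * θ j).card := by
    simp only [Finset.card_filter]
    refine Finset.measurable_sum _ fun j _ => ?_
    exact Measurable.ite (measurableSet_le measurable_const (by fun_prop))
      measurable_const measurable_const
  exact measurableSet_lt this measurable_const

/-- Whether the slot of arm `i` is open is independent of the sample of arm `i`. -/
lemma sampleLaw_openSlot_inter {t : ℕ} (h : History N t) (b w : Fin N → ℝ) (m : ℕ)
    (S : Finset (Fin N)) (i : Fin N) (y : ℝ) {s : Set ℝ} (hs : MeasurableSet s) :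
    (sampleLaw h).real (openSlot b w m S i y ∩ {θ | θ i ∈ s}) =
      (sampleLaw h).real (openSlot b w m S i y) * (sampleLaw h).real {θ | θ i ∈ s} := by
  have hind : iIndepFun (fun (i : Fin N) (θ : Fin N → ℝ) => θ i) (sampleLaw h) := by
    rw [sampleLaw_eq]
    exact iIndepFun_pi (X := fun _ => id) fun _ => aemeasurable_id
  have hdis : Disjoint ({i}ᶜ : Finset (Fin N)) {i} := by simp
  have hI := hind.indepFun_finset _ _ hdis fun j => measurable_pi_apply j
  -- the slot depends on the other coordinates only, so they may be completed by zero
  let ext : (({i}ᶜ : Finset (Fin N)) → ℝ) → Fin N → ℝ := fun φ j =>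
    if hj : j ∈ ({i}ᶜ : Finset (Fin N)) then φ ⟨j, hj⟩ else 0
  have hext : Measurable ext := by
    refine measurable_pi_lambda _ fun j => ?_
    by_cases hj : j ∈ ({i}ᶜ : Finset (Fin N))
    · simp only [ext, hj, dif_pos]; exact measurable_pi_apply _
    · simp only [ext, hj, dif_neg, not_false_eq_true]; exact measurable_const
  have e1 : openSlot b w m S i y =
      (fun (θ : Fin N → ℝ) (j : ({i}ᶜ : Finset (Fin N))) => θ j) ⁻¹'
        (ext ⁻¹' openSlot b w m S i y) := by
    ext θ
    simp only [openSlot, Set.mem_ofPred_eq, Set.mem_preimage]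
    have : (S.erase i).filter (fun j => b i + w i * y ≤ b j + w j * θ j) =
        (S.erase i).filter (fun j => b i + w i * y ≤ b j + w j *
          ext (fun j : ({i}ᶜ : Finset (Fin N)) => θ j) j) := by
      refine Finset.filter_congr fun j hj => ?_
      have hj' : j ∈ ({i}ᶜ : Finset (Fin N)) := by simpa using Finset.ne_of_mem_erase hj
      simp only [ext, hj', dif_pos]
    rw [this]
  have e2 : {θ : Fin N → ℝ | θ i ∈ s} =
      (fun (θ : Fin N → ℝ) (j : ({i} : Finset (Fin N))) => θ j) ⁻¹'
        {φ | φ ⟨i, Finset.mem_singleton_self i⟩ ∈ s} := rfl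
  have := hI.measure_inter_preimage_eq_mul _ _
    (hext (measurableSet_openSlot b w m S i y))
    (show MeasurableSet {φ : ({i} : Finset (Fin N)) → ℝ |
      φ ⟨i, Finset.mem_singleton_self i⟩ ∈ s} from (measurable_pi_apply _) hs)
  rw [← e1, ← e2] at this
  rw [Measure.real, this, ENNReal.toReal_mul]; rfl

variable {B : Bandit N} {m : ℕ} {k : Fin N → ℝ} {lam : ℝ}

lemma integrable_select (R : ArgmaxRule B m k lam) {t : ℕ} (h : History N t)
    (S A : Finset (Fin N)) :
    Integrable (fun θ => (R.select t h S θ A).toReal) (sampleLaw h) := by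
  refine Integrable.of_bound (C := 1)
    (R.measurable_select t h S A).ennreal_toReal.aestronglyMeasurable (ae_of_all _ fun θ => ?_)
  rw [Real.norm_of_nonneg ENNReal.toReal_nonneg]
  exact ENNReal.toReal_le_of_le_ofReal zero_le_one (by simpa using PMF.coe_le_one _ _)

lemma integrable_expect_select (R : ArgmaxRule B m k lam) {t : ℕ} (h : History N t)
    (S : Finset (Fin N)) (f : Finset (Fin N) → ℝ) :
    Integrable (fun θ => expect (R.select t h S θ) f) (sampleLaw h) :=
  integrable_finsetSum _ fun A _ => (integrable_select R h S A).mul_const _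

lemma expect_actionLaw (R : ArgmaxRule B m k lam) {t : ℕ} (h : History N t)
    (S : Finset (Fin N)) (f : Finset (Fin N) → ℝ) :
    expect (actionLaw R h S) f = ∫ θ, expect (R.select t h S θ) f ∂(sampleLaw h) := by
  simp only [expect]
  rw [integral_finsetSum _ fun A _ => (integrable_select R h S A).mul_const _]
  refine Finset.sum_congr rfl fun A _ => ?_
  rw [integral_mul_const, integral_toReal (R.measurable_select t h S A).aemeasurable
    (ae_of_all _ fun θ => (PMF.apply_lt_top _ _))]
  rfl

/-- The indicator that an arm belongs to a set of arms. -/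
noncomputable def pulls (i : Fin N) (A : Finset (Fin N)) : ℝ := if i ∈ A then 1 else 0

lemma pulls_nonneg (i : Fin N) (A : Finset (Fin N)) : 0 ≤ pulls i A := by
  unfold pulls; split_ifs <;> norm_num

lemma pulls_le_one (i : Fin N) (A : Finset (Fin N)) : pulls i A ≤ 1 := by
  unfold pulls; split_ifs <;> norm_num

lemma sum_eq_sum_mul_pulls (A : Finset (Fin N)) (f : Fin N → ℝ) :
    ∑ i ∈ A, f i = ∑ i, f i * pulls i A := by
  simp [pulls]

lemma expect_sum_mem (p : PMF (Finset (Fin N))) (f : Fin N → ℝ) :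
    expect p (fun A => ∑ i ∈ A, f i) = ∑ i, f i * expect p (pulls i) := by
  simp only [sum_eq_sum_mul_pulls _ f, expect_sum, expect_const_mul]

/-- An arm is rarely passed over because of a low sample, compared to how often it is pulled: given
that its slot is open it is pulled unless its sample is low, independently of the slot. -/
lemma openSlot_inter_lt_le (hm : 0 < m) (hlam : 0 ≤ lam) (R : ArgmaxRule B m k lam) {t : ℕ}
    (h : History N t) {S : Finset (Fin N)} {i : Fin N} (hi : i ∈ S) {y δ : ℝ} (h0 : 0 ≤ y)
    (h1 : y ≤ 1) (hδ : 0 < δ) :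
    (sampleLaw h).real (openSlot (fun j => lam * queue k h j) B.weight m S i y ∩
        {θ | θ i < y}) ≤
      missRatio δ y (succCount h i) (failCount h i) * expect (actionLaw R h S) (pulls i) +
        missError δ y (succCount h i) (failCount h i) := by
  set E := openSlot (fun j => lam * queue k h j) B.weight m S i y with hE
  have hQ : ∀ j, 0 ≤ lam * queue k h j := fun j => mul_nonneg hlam (le_max_right _ _)
  set p := upperTail y (succCount h i) (failCount h i) with hp
  have hp0 : 0 ≤ p := upperTail_nonneg h0 h1 _ _
  have hp1 : p ≤ 1 := upperTail_le_one h0 h1 _ _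
  set a := (sampleLaw h).real E with ha
  have ha0 : 0 ≤ a := measureReal_nonneg
  have ha1 : a ≤ 1 := measureReal_le_one
  have hlow : (sampleLaw h).real (E ∩ {θ | θ i < y}) ≤ a * (1 - p) := by
    refine (sampleLaw_openSlot_inter h _ _ m S i y measurableSet_Iio).trans_le ?_
    exact mul_le_mul_of_nonneg_left (sampleLaw_real_lt_le h i h0 h1) ha0
  have hpull : a * p ≤ expect (actionLaw R h S) (pulls i) := by
    have e : (sampleLaw h).real (E ∩ {θ | y < θ i}) = a * p := by
      refine (sampleLaw_openSlot_inter h _ _ m S i y measurableSet_Ioi).trans ?_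
      rw [hp, ← sampleLaw_real_gt h i h0 h1]; rfl
    have hmeas : MeasurableSet (E ∩ {θ : Fin N → ℝ | y < θ i}) :=
      (measurableSet_openSlot _ _ _ _ _ _).inter
        (measurableSet_lt measurable_const (measurable_pi_apply i))
    rw [← e, ← integral_indicator_one hmeas, expect_actionLaw]
    refine integral_mono_ae ?_ (integrable_expect_select R h S _) ?_
    · exact (integrable_const (1 : ℝ)).indicator hmeas
    · filter_upwards [ae_mem_unit h] with θ hθ
      by_cases hmem : θ ∈ E ∩ {θ : Fin N → ℝ | y < θ i}
      · rw [Set.indicator_of_mem hmem, Pi.one_apply,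
          ← expect_const (R.select t h S θ) 1]
        refine expect_mono_of_ne_zero fun A hA => ?_
        have : i ∈ A := mem_of_openSlot hm
          (fun j => add_nonneg (hQ j) (mul_nonneg (B.weight_nonneg j) (hθ j).1)) (hQ i) h0 hi
          (R.select_mem t h S θ A hA) (R.select_max t h S θ A hA) hmem.1 hmem.2
        simp [pulls, this]
      · rw [Set.indicator_of_notMem hmem]
        exact expect_nonneg fun A => pulls_nonneg i A
  have hpδ : 0 < p + δ := by linarith
  have hr : 0 ≤ (1 - p) / (p + δ) := div_nonneg (by linarith) hpδ.le
  calc _ ≤ a * (1 - p) := hlow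
    _ = (1 - p) / (p + δ) * (a * p) + δ / (p + δ) * (a * (1 - p)) := by field_simp
    _ ≤ (1 - p) / (p + δ) * expect (actionLaw R h S) (pulls i) + δ / (p + δ) * 1 := by
        refine add_le_add (mul_le_mul_of_nonneg_left hpull hr)
          (mul_le_mul_of_nonneg_left ?_ (div_nonneg hδ.le hpδ.le))
        nlinarith
    _ = _ := by rw [mul_one]; rfl

lemma integrable_indicator_mul_expect (R : ArgmaxRule B m k lam) {t : ℕ} (h : History N t)
    (S : Finset (Fin N)) (i : Fin N) (y : ℝ) :
    Integrable (fun θ => {θ : Fin N → ℝ | y < θ i}.indicator 1 θ *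
      expect (R.select t h S θ) (pulls i)) (sampleLaw h) := by
  have hmeas : MeasurableSet {θ : Fin N → ℝ | y < θ i} :=
    measurableSet_lt measurable_const (measurable_pi_apply i)
  have := (integrable_expect_select R h S (pulls i)).indicator hmeas
  refine this.congr (ae_of_all _ fun θ => ?_)
  by_cases hmem : θ ∈ {θ : Fin N → ℝ | y < θ i}
  · simp only [Set.indicator_of_mem hmem, Pi.one_apply, one_mul]
  · simp only [Set.indicator_of_notMem hmem, zero_mul]

/-- Pulls of an arm with a sample above `y` are charged to the pull as long as there are few of
them, and to the tail of the posterior afterwards. -/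
lemma integral_indicator_mul_expect_le (R : ArgmaxRule B m k lam) {t : ℕ} (h : History N t)
    (S : Finset (Fin N)) (i : Fin N) {y : ℝ} (z : ℝ) (h0 : 0 ≤ y) (h1 : y ≤ 1) :
    ∫ θ, {θ : Fin N → ℝ | y < θ i}.indicator 1 θ * expect (R.select t h S θ) (pulls i)
        ∂(sampleLaw h) ≤
      fewPulls z (succCount h i) (failCount h i) * expect (actionLaw R h S) (pulls i) +
        lateTail z y (succCount h i) (failCount h i) := by
  have hmeas : MeasurableSet {θ : Fin N → ℝ | y < θ i} :=
    measurableSet_lt measurable_const (measurable_pi_apply i)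
  have hint := integrable_indicator_mul_expect R h S i y
  have hind : ∀ θ, {θ : Fin N → ℝ | y < θ i}.indicator (1 : (Fin N → ℝ) → ℝ) θ ≤ 1 := fun θ =>
    Set.indicator_le_self' (fun _ _ => zero_le_one) θ
  have hind0 : ∀ θ, 0 ≤ {θ : Fin N → ℝ | y < θ i}.indicator (1 : (Fin N → ℝ) → ℝ) θ := fun θ =>
    Set.indicator_nonneg (fun _ _ => zero_le_one) θ
  unfold fewPulls lateTail
  split_ifs with hz
  · rw [one_mul, add_zero, expect_actionLaw]
    refine integral_mono hint (integrable_expect_select R h S _) fun θ => ?_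
    exact mul_le_of_le_one_left (expect_nonneg fun A => pulls_nonneg i A) (hind θ)
  · rw [zero_mul, zero_add, ← sampleLaw_real_gt h i h0 h1, ← integral_indicator_one hmeas]
    refine integral_mono hint ((integrable_const (1 : ℝ)).indicator hmeas) fun θ => ?_
    refine mul_le_of_le_one_right (hind0 θ) ?_
    rw [← expect_const (R.select t h S θ) 1]
    exact expect_mono fun A => pulls_le_one i A

/-- The charge for a pull of an arm with mean `u`, at the level `x` and for the horizon `T`. The
regularization `T⁻⁴` is small enough for `roundCharge` to be summed over `T` rounds, and a posterior
from `16 * log T / x ^ 2` pulls is concentrated up to `x`. The levels are truncated to `[0, 1]`. -/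
noncomputable def pullCharge (T : ℕ) (x u : ℝ) (s r : ℕ) : ℝ :=
  missRatio ((T : ℝ) ^ 4)⁻¹ (max (u - x) 0) s r + fewPulls (16 * Real.log T / x ^ 2) s r

/-- The charge for a round, whether or not the arm is pulled. -/
noncomputable def roundCharge (T : ℕ) (x u : ℝ) (s r : ℕ) : ℝ :=
  missError ((T : ℝ) ^ 4)⁻¹ (max (u - x) 0) s r +
    lateTail (16 * Real.log T / x ^ 2) (min (u + x) 1) s r

/-- Given the history and the available arms, the expected loss against any admissible set, where
the true means are shifted by the queue terms, is bounded by charges to the arms. -/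
lemma expect_actionLaw_gap_le (hm : 0 < m) (hlam : 0 ≤ lam) (R : ArgmaxRule B m k lam) {t : ℕ}
    (h : History N t) {S Aopt : Finset (Fin N)} (hAopt : Aopt ∈ actions m S) {W : ℝ}
    (hW : ∀ i, B.weight i ≤ W) (hW0 : 0 ≤ W) {T : ℕ} (hT : 0 < T) (L : ℕ) :
    expect (actionLaw R h S) (fun A =>
        ∑ i ∈ Aopt, (lam * queue k h i + B.weight i * B.mean i) -
          ∑ i ∈ A, (lam * queue k h i + B.weight i * B.mean i)) ≤
      W * (2 * m * (1 / 2) ^ L + ∑ l ∈ Finset.range L, (1 / 2 : ℝ) ^ (l + 1) * ∑ i,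
        (pullCharge T ((1 / 2) ^ (l + 1)) (B.mean i) (succCount h i) (failCount h i) *
            expect (actionLaw R h S) (pulls i) +
          roundCharge T ((1 / 2) ^ (l + 1)) (B.mean i) (succCount h i) (failCount h i))) := by
  have hQ : ∀ j, 0 ≤ lam * queue k h j := fun j => mul_nonneg hlam (le_max_right _ _)
  have hδ : (0 : ℝ) < ((T : ℝ) ^ 4)⁻¹ := by positivity
  have hx : ∀ l : ℕ, (0 : ℝ) < (1 / 2) ^ (l + 1) := fun l => by positivity
  have hlo0 : ∀ (l : ℕ) i, 0 ≤ max (B.mean i - (1 / 2) ^ (l + 1)) 0 := fun l i => le_max_right _ _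
  have hlo1 : ∀ (l : ℕ) i, max (B.mean i - (1 / 2) ^ (l + 1)) 0 ≤ 1 := fun l i =>
    max_le (by linarith [(B.mean_mem i).2, hx l]) zero_le_one
  have hhi0 : ∀ (l : ℕ) i, 0 ≤ min (B.mean i + (1 / 2) ^ (l + 1)) 1 := fun l i =>
    le_min (by linarith [(B.mean_mem i).1, hx l]) zero_le_one
  have hhi1 : ∀ (l : ℕ) i, min (B.mean i + (1 / 2) ^ (l + 1)) 1 ≤ 1 := fun l i => min_le_right _ _
  set lowSet : ℕ → Fin N → Set (Fin N → ℝ) := fun l i =>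
    openSlot (fun j => lam * queue k h j) B.weight m S i (max (B.mean i - (1 / 2) ^ (l + 1)) 0) ∩
      {θ | θ i < max (B.mean i - (1 / 2) ^ (l + 1)) 0} with hlowSet
  have hlowm : ∀ l i, MeasurableSet (lowSet l i) := fun l i =>
    (measurableSet_openSlot _ _ _ _ _ _).inter
      (measurableSet_lt (measurable_pi_apply i) measurable_const)
  have i1 : ∀ l i, Integrable ((lowSet l i).indicator (1 : (Fin N → ℝ) → ℝ)) (sampleLaw h) :=
    fun l i => (integrable_const (1 : ℝ)).indicator (hlowm l i)
  have i2 := fun (l : ℕ) i =>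
    integrable_indicator_mul_expect R h S i (min (B.mean i + (1 / 2) ^ (l + 1)) 1)
  have i3 : ∀ l : ℕ, Integrable (fun θ => ∑ i ∈ S, (lowSet l i).indicator 1 θ + ∑ i,
      {θ : Fin N → ℝ | min (B.mean i + (1 / 2) ^ (l + 1)) 1 < θ i}.indicator 1 θ *
        expect (R.select t h S θ) (pulls i)) (sampleLaw h) := fun l =>
    (integrable_finsetSum _ fun i _ => i1 l i).add (integrable_finsetSum _ fun i _ => i2 l i)
  have i4 : Integrable (fun θ => ∑ l ∈ Finset.range L, (1 / 2 : ℝ) ^ (l + 1) *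
      (∑ i ∈ S, (lowSet l i).indicator 1 θ + ∑ i,
      {θ : Fin N → ℝ | min (B.mean i + (1 / 2) ^ (l + 1)) 1 < θ i}.indicator 1 θ *
        expect (R.select t h S θ) (pulls i))) (sampleLaw h) :=
    integrable_finsetSum _ fun l _ => (i3 l).const_mul _
  rw [expect_actionLaw]
  calc _ ≤ ∫ θ, W * (2 * m * (1 / 2) ^ L + ∑ l ∈ Finset.range L, (1 / 2 : ℝ) ^ (l + 1) *
        (∑ i ∈ S, (lowSet l i).indicator 1 θ + ∑ i,
        {θ : Fin N → ℝ | min (B.mean i + (1 / 2) ^ (l + 1)) 1 < θ i}.indicator 1 θ *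
          expect (R.select t h S θ) (pulls i))) ∂(sampleLaw h) := by
        refine integral_mono_ae (integrable_expect_select R h S _)
          (((integrable_const _).add i4).const_mul W) ?_
        filter_upwards [ae_mem_unit h] with θ hθ
        refine (expect_mono_of_ne_zero fun A hA => sum_sub_sum_le hm hQ B.weight_nonneg hW hW0
          (fun i => (B.mean_mem i).1) (fun i => (B.mean_mem i).2) (fun i => (hθ i).1)
          (fun i => (hθ i).2) hAopt (R.select_mem t h S θ A hA)
          (R.select_max t h S θ A hA) L).trans (le_of_eq ?_)
        simp only [expect_const_mul, expect_add, expect_sum _ (Finset.range L), expect_const,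
          expect_sum_mem]
        rfl
    _ = W * (2 * m * (1 / 2) ^ L + ∑ l ∈ Finset.range L, (1 / 2 : ℝ) ^ (l + 1) *
        (∑ i ∈ S, (sampleLaw h).real (lowSet l i) + ∑ i, ∫ θ,
          {θ : Fin N → ℝ | min (B.mean i + (1 / 2) ^ (l + 1)) 1 < θ i}.indicator 1 θ *
          expect (R.select t h S θ) (pulls i) ∂(sampleLaw h))) := by
        rw [integral_const_mul, integral_add (integrable_const _) i4, integral_const,
          integral_finsetSum _ fun l _ => (i3 l).const_mul _]
        simp only [probReal_univ, one_smul]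
        congr 2
        refine Finset.sum_congr rfl fun l _ => ?_
        rw [integral_const_mul, integral_add (integrable_finsetSum _ fun i _ => i1 l i)
          (integrable_finsetSum _ fun i _ => i2 l i), integral_finsetSum _ fun i _ => i1 l i,
          integral_finsetSum _ fun i _ => i2 l i]
        simp only [integral_indicator_one (hlowm l _)]
    _ ≤ _ := by
        refine mul_le_mul_of_nonneg_left (add_le_add_right (Finset.sum_le_sum fun l _ =>
          mul_le_mul_of_nonneg_left ?_ (hx l).le) _) hW0
        have hpos : ∀ i, 0 ≤ expect (actionLaw R h S) (pulls i) := fun i =>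
          expect_nonneg fun A => pulls_nonneg i A
        have hS : ∑ i ∈ S, (sampleLaw h).real (lowSet l i) ≤ ∑ i,
            (missRatio ((T : ℝ) ^ 4)⁻¹ (max (B.mean i - (1 / 2) ^ (l + 1)) 0) (succCount h i)
              (failCount h i) * expect (actionLaw R h S) (pulls i) +
            missError ((T : ℝ) ^ 4)⁻¹ (max (B.mean i - (1 / 2) ^ (l + 1)) 0) (succCount h i)
              (failCount h i)) :=
          (Finset.sum_le_sum fun i hi => openSlot_inter_lt_le hm hlam R h hi (hlo0 l i)
            (hlo1 l i) hδ).trans (Finset.sum_le_sum_of_subset_of_nonneg (Finset.subset_univ S)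
              fun i _ _ => add_nonneg (mul_nonneg (missRatio_nonneg hδ (hlo0 l i) (hlo1 l i) _ _)
                (hpos i)) (missError_nonneg hδ (hlo0 l i) (hlo1 l i) _ _))
        have hU := Finset.sum_le_sum fun i (_ : i ∈ Finset.univ) =>
          integral_indicator_mul_expect_le R h S i
            (16 * Real.log T / ((1 / 2 : ℝ) ^ (l + 1)) ^ 2) (hhi0 l i) (hhi1 l i)
        refine (add_le_add hS hU).trans (le_of_eq ?_)
        rw [← Finset.sum_add_distrib]
        refine Finset.sum_congr rfl fun i _ => ?_
        rw [pullCharge, roundCharge]; ring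

/-! ### The law of the history -/

lemma expect_comm {α β : Type*} [Fintype α] [Fintype β] (p : PMF α) (q : PMF β) (f : α → β → ℝ) :
    expect p (fun a => expect q (f a)) = expect q fun b => expect p fun a => f a b := by
  simp only [expect, Finset.mul_sum]
  rw [Finset.sum_comm]
  exact Finset.sum_congr rfl fun _ _ => Finset.sum_congr rfl fun _ _ => by ring

lemma expect_roundLaw (R : ArgmaxRule B m k lam) (q : Policy N) {t : ℕ} (h : History N t)
    (f : Round N → ℝ) :
    expect (roundLaw R q h) f = expect B.availability fun S => expect (actionLaw R h S) fun A =>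
      expect (q S) fun Aopt => expect (rewardLaw B) fun x => f ⟨S, A, Aopt, x⟩ := by
  simp only [roundLaw, expect_bind, expect_map]

lemma expect_historyLaw_succ (R : ArgmaxRule B m k lam) (q : Policy N) (t : ℕ)
    (f : History N (t + 1) → ℝ) :
    expect (historyLaw R q (t + 1)) f = expect (historyLaw R q t) fun h =>
      expect (roundLaw R q h) fun r => f (Fin.snoc (α := fun _ => Round N) h r) := by
  rw [historyLaw, expect_bind]
  simp only [expect_map]

lemma expect_historyLaw_zero (R : ArgmaxRule B m k lam) (q : Policy N) (f : History N 0 → ℝ) :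
    expect (historyLaw R q 0) f = f Fin.elim0 := by
  rw [historyLaw, expect_pure]

/-- The expectation of a sum over the rounds, as a sum over the histories before each round. -/
lemma expect_historyLaw_sum (R : ArgmaxRule B m k lam) (q : Policy N) (d : Round N → ℝ) (T : ℕ) :
    expect (historyLaw R q T) (fun h => ∑ t, d (h t)) =
      ∑ t ∈ Finset.range T, expect (historyLaw R q t) fun h => expect (roundLaw R q h) d := by
  induction T with
  | zero => simp [expect]
  | succ T ih =>
    rw [Finset.sum_range_succ, ← ih, expect_historyLaw_succ, ← expect_add]
    congr 1; funext h
    simp only [Fin.sum_univ_castSucc, Fin.snoc_castSucc, Fin.snoc_last, expect_add, expect_const]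

lemma expect_rewardLaw (B : Bandit N) (i : Fin N) (g : Bool → ℝ) :
    expect (rewardLaw B) (fun x => g (x i)) =
      B.mean i * g true + (1 - B.mean i) * g false := by
  have h : ∀ x : Fin N → Bool, ((rewardLaw B) x).toReal * g (x i) =
      ∏ j, (if x j then B.mean j else 1 - B.mean j) * (if j = i then g (x j) else 1) := by
    intro x
    rw [Finset.prod_mul_distrib]
    congr 1
    · change (∏ j, ENNReal.ofReal (if x j then B.mean j else 1 - B.mean j)).toReal = _
      rw [ENNReal.toReal_prod]
      refine Finset.prod_congr rfl fun j _ => ENNReal.toReal_ofReal ?_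
      have := B.mean_mem j
      split_ifs <;> linarith [this.1, this.2]
    · simp
  simp only [expect, h]
  rw [← Fintype.prod_sum fun (j : Fin N) (b : Bool) =>
    (if b then B.mean j else 1 - B.mean j) * (if j = i then g b else 1),
    Finset.prod_eq_single i]
  · simp
  · intro j _ hj; simp [hj]
  · simp

/-! ### Charging the pulls along the counts -/

lemma succCount_snoc {t : ℕ} (h : History N t) (r : Round N) (i : Fin N) :
    succCount (Fin.snoc (α := fun _ => Round N) h r : History N (t + 1)) i = succCount h i +
      if i ∈ r.pulled then (if r.reward i then 1 else 0) else 0 := by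
  simp only [succCount, Fin.sum_univ_castSucc, Fin.snoc_castSucc, Fin.snoc_last]

lemma failCount_snoc {t : ℕ} (h : History N t) (r : Round N) (i : Fin N) :
    failCount (Fin.snoc (α := fun _ => Round N) h r : History N (t + 1)) i = failCount h i +
      if i ∈ r.pulled then (if r.reward i then 0 else 1) else 0 := by
  simp only [failCount, Fin.sum_univ_castSucc, Fin.snoc_castSucc, Fin.snoc_last]

/-- A round pays for the charge of a pull out of the potential `pathSum`. -/
lemma expect_roundLaw_pathSum_le (R : ArgmaxRule B m k lam) (q : Policy N) {t : ℕ}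
    (h : History N t) (i : Fin N) {f : ℕ → ℕ → ℝ} (hf : ∀ s r, 0 ≤ f s r) (n : ℕ) :
    f (succCount h i) (failCount h i) * expect (roundLaw R q h) (fun r => pulls i r.pulled) +
      expect (roundLaw R q h) (fun r => pathSum (B.mean i) f n
        (succCount (Fin.snoc (α := fun _ => Round N) h r : History N (t + 1)) i)
        (failCount (Fin.snoc (α := fun _ => Round N) h r : History N (t + 1)) i)) ≤
      pathSum (B.mean i) f (n + 1) (succCount h i) (failCount h i) := by
  obtain ⟨hu0, hu1⟩ := B.mean_mem i
  rw [← expect_const_mul, ← expect_add, expect_roundLaw]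
  set C := pathSum (B.mean i) f (n + 1) (succCount h i) (failCount h i) with hC
  rw [← expect_const B.availability C]
  refine expect_mono fun S => ?_
  rw [← expect_const (actionLaw R h S) C]
  refine expect_mono fun A => ?_
  rw [← expect_const (q S) C]
  refine expect_mono fun Aopt => ?_
  simp only [succCount_snoc, failCount_snoc]
  by_cases hi : i ∈ A
  · simp only [hi, if_true, pulls, mul_one]
    rw [expect_rewardLaw B i fun b => f (succCount h i) (failCount h i) +
      pathSum (B.mean i) f n (succCount h i + if b then 1 else 0)
        (failCount h i + if b then 0 else 1), hC, pathSum_succ]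
    simp only [if_true, Bool.false_eq_true, if_false, add_zero]
    linarith
  · simp only [hi, if_false, pulls, mul_zero, zero_add, add_zero, expect_const]
    exact pathSum_mono hu0 hu1 hf (Nat.le_succ n) _ _

/-- The total charge for the pulls of an arm is at most the expected charge along a full sequence
of `T` pulls of the arm. -/
lemma sum_expect_mul_pulls_le (R : ArgmaxRule B m k lam) (q : Policy N) (i : Fin N)
    {f : ℕ → ℕ → ℝ} (hf : ∀ s r, 0 ≤ f s r) (T : ℕ) :
    ∑ t ∈ Finset.range T, expect (historyLaw R q t) (fun h =>
        f (succCount h i) (failCount h i) *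
          expect (roundLaw R q h) (fun r => pulls i r.pulled)) ≤
      pathSum (B.mean i) f T 0 0 := by
  obtain ⟨hu0, hu1⟩ := B.mean_mem i
  have key : ∀ t n, ∑ t ∈ Finset.range t, expect (historyLaw R q t) (fun h =>
        f (succCount h i) (failCount h i) *
          expect (roundLaw R q h) (fun r => pulls i r.pulled)) +
      expect (historyLaw R q t) (fun h =>
        pathSum (B.mean i) f n (succCount h i) (failCount h i)) ≤
      pathSum (B.mean i) f (n + t) 0 0 := by
    intro t
    induction t with
    | zero => intro n; simp [expect_historyLaw_zero, succCount, failCount]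
    | succ t ih =>
      intro n
      refine le_trans ?_ ((ih (n + 1)).trans_eq (by rw [add_assoc, add_comm 1]))
      rw [Finset.sum_range_succ, add_assoc, expect_historyLaw_succ, ← expect_add]
      exact add_le_add_right (expect_mono fun h => expect_roundLaw_pathSum_le R q h i hf n) _
  simpa [pathSum_zero, expect_const] using key T 0

/-- The expectation of a function of the counts in one round is at most its expected sum along a
full sequence of pulls of the arm. -/
lemma expect_counts_le (R : ArgmaxRule B m k lam) (q : Policy N) (i : Fin N)
    {g : ℕ → ℕ → ℝ} (hg : ∀ s r, 0 ≤ g s r) {t T : ℕ} (ht : t < T) :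
    expect (historyLaw R q t) (fun h => g (succCount h i) (failCount h i)) ≤
      pathSum (B.mean i) g T 0 0 := by
  obtain ⟨hu0, hu1⟩ := B.mean_mem i
  have key : ∀ t n, expect (historyLaw R q t) (fun h =>
        pathSum (B.mean i) g n (succCount h i) (failCount h i)) ≤
      pathSum (B.mean i) g (n + t) 0 0 := by
    intro t
    induction t with
    | zero => intro n; simp [expect_historyLaw_zero, succCount, failCount]
    | succ t ih =>
      intro n
      refine le_trans ?_ ((ih (n + 1)).trans_eq (by rw [add_assoc, add_comm 1]))
      rw [expect_historyLaw_succ]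
      refine expect_mono fun h => le_trans ?_ (expect_roundLaw_pathSum_le R q h i hg n)
      exact le_add_of_nonneg_left (mul_nonneg (hg _ _) (expect_nonneg fun r => pulls_nonneg i _))
  have h1 := (key t 1).trans (pathSum_mono hu0 hu1 hg (show 1 + t ≤ T by omega) 0 0)
  simpa [pathSum_succ, pathSum_zero] using h1

/-! ### The drift of the queues -/

/-- One step of a queue. For a negative rate `k` the queue stays empty, so that the increment need
not be bounded below. -/
lemma max_add_sq_le {a k p : ℝ} (hk : k ≤ 1) (hp0 : 0 ≤ p) (hp1 : p ≤ 1) (ha : k ≤ 0 → a ≤ 0) :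
    max (a + (k - p)) 0 ^ 2 ≤ max a 0 ^ 2 + 2 * (max a 0 * (k - p)) + 1 := by
  rcases le_total k 0 with h | h
  · rw [max_eq_right (ha h), max_eq_right (by linarith [ha h])]; norm_num
  · have hd : (k - p) ^ 2 ≤ 1 := by nlinarith
    rcases le_total (a + (k - p)) 0 with h1 | h1
    · rw [max_eq_right h1]; nlinarith [sq_nonneg (max a 0 + (k - p))]
    · rw [max_eq_left h1]
      rcases le_total a 0 with h2 | h2
      · rw [max_eq_right h2]; nlinarith
      · rw [max_eq_left h2]; nlinarith

lemma queue_snoc {t : ℕ} (k : Fin N → ℝ) (h : History N t) (r : Round N) (i : Fin N) :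
    queue k (Fin.snoc (α := fun _ => Round N) h r : History N (t + 1)) i =
      max ((t * k i - ∑ s, if i ∈ (h s).pulled then (1 : ℝ) else 0) + (k i - pulls i r.pulled))
        0 := by
  simp only [queue, Fin.sum_univ_castSucc, Fin.snoc_castSucc, Fin.snoc_last, pulls]
  push_cast; ring_nf

/-- The quadratic Lyapunov function of the queues. -/
noncomputable def lyapunov (k : Fin N → ℝ) {t : ℕ} (h : History N t) : ℝ := ∑ i, queue k h i ^ 2

lemma expect_roundLaw_lyapunov_le (hk : ∀ i, k i ≤ 1) (R : ArgmaxRule B m k lam) (q : Policy N)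
    {t : ℕ} (h : History N t) :
    expect (roundLaw R q h) (fun r =>
        lyapunov k (Fin.snoc (α := fun _ => Round N) h r : History N (t + 1))) +
      2 * ∑ i, queue k h i * (expect (roundLaw R q h) (fun r => pulls i r.pulled) - k i) ≤
      lyapunov k h + N := by
  have e : 2 * ∑ i, queue k h i * (expect (roundLaw R q h) (fun r => pulls i r.pulled) - k i) =
      expect (roundLaw R q h) fun r => ∑ i, 2 * (queue k h i * (pulls i r.pulled - k i)) := by
    rw [expect_sum, Finset.mul_sum]
    simp only [expect_const_mul, expect_sub, expect_const]
  rw [e, ← expect_add, ← expect_const (roundLaw R q h) (lyapunov k h + N)]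
  refine expect_mono fun r => ?_
  have hN : (N : ℝ) = ∑ _i : Fin N, (1 : ℝ) := by simp
  rw [hN, lyapunov, lyapunov, ← Finset.sum_add_distrib, ← Finset.sum_add_distrib]
  refine Finset.sum_le_sum fun i _ => ?_
  rw [queue_snoc]
  have h0 : 0 ≤ ∑ s, if i ∈ (h s).pulled then (1 : ℝ) else 0 :=
    Finset.sum_nonneg fun s _ => by split_ifs <;> norm_num
  have := max_add_sq_le (a := t * k i - ∑ s, if i ∈ (h s).pulled then (1 : ℝ) else 0) (hk i)
    (pulls_nonneg i r.pulled) (pulls_le_one i r.pulled) fun hk0 => by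
      have : (t : ℝ) * k i ≤ 0 := mul_nonpos_of_nonneg_of_nonpos (Nat.cast_nonneg t) hk0
      linarith
  change _ ≤ queue k h i ^ 2 + 2 * (queue k h i * (k i - pulls i r.pulled)) + 1 at this
  linarith

/-- The queues are weighted in favour of the pulled arms by at most `N * T / 2` in total. -/
lemma sum_expect_queue_le (hk : ∀ i, k i ≤ 1) (R : ArgmaxRule B m k lam) (q : Policy N) (T : ℕ) :
    ∑ t ∈ Finset.range T, expect (historyLaw R q t) (fun h => ∑ i, queue k h i *
      (expect (roundLaw R q h) (fun r => pulls i r.pulled) - k i)) ≤ N * T / 2 := by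
  have key : ∀ T : ℕ, 2 * ∑ t ∈ Finset.range T, expect (historyLaw R q t) (fun h =>
      ∑ i, queue k h i * (expect (roundLaw R q h) (fun r => pulls i r.pulled) - k i)) +
      expect (historyLaw R q T) (lyapunov k) ≤ N * T := by
    intro T
    induction T with
    | zero => simp [expect_historyLaw_zero, lyapunov, queue]
    | succ T ih =>
      have := expect_mono (p := historyLaw R q T)
        fun h => expect_roundLaw_lyapunov_le hk R q h
      rw [expect_add, expect_add, expect_const, expect_const_mul, ← expect_historyLaw_succ] at this
      rw [Finset.sum_range_succ]
      push_cast
      linarith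
  have h1 := key T
  have h2 : 0 ≤ expect (historyLaw R q T) (lyapunov k) :=
    expect_nonneg fun h => Finset.sum_nonneg fun i _ => sq_nonneg _
  linarith

/-! ### The regret of a round -/

lemma le_expect_pulls {q : Policy N} (hq : IsFeasible B m k q) (i : Fin N) :
    k i ≤ expect B.availability fun S => expect (q S) (pulls i) := by
  refine (hq.2 i).trans_eq (Finset.sum_congr rfl fun S _ => ?_)
  congr 1
  change _ = ∑ A, (q S A).toReal * pulls i A
  rw [Finset.sum_filter]
  refine Finset.sum_subset (Finset.subset_univ _) (fun A _ hA => ?_) |>.trans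
    (Finset.sum_congr rfl fun A _ => ?_)
  · have : q S A = 0 := by
      by_contra hne; exact hA (hq.1 S A hne)
    simp [this]
  · simp [pulls]

lemma le_one_of_isFeasible {q : Policy N} (hq : IsFeasible B m k q) (i : Fin N) : k i ≤ 1 := by
  refine (le_expect_pulls hq i).trans ?_
  rw [← expect_const B.availability 1]
  refine expect_mono fun S => ?_
  rw [← expect_const (q S) 1]
  exact expect_mono fun A => pulls_le_one i A

/-- The difference of the rewards collected in a round by the benchmark and by the algorithm. -/
def roundRegret (B : Bandit N) (r : Round N) : ℝ :=
  (∑ i ∈ r.optimal, B.weight i * r.X i) - ∑ i ∈ r.pulled, B.weight i * r.X i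

lemma expect_roundLaw_pulls (R : ArgmaxRule B m k lam) (q : Policy N) {t : ℕ} (h : History N t)
    (i : Fin N) : expect (roundLaw R q h) (fun r => pulls i r.pulled) =
      expect B.availability fun S => expect (actionLaw R h S) (pulls i) := by
  simp only [expect_roundLaw, expect_const]

lemma expect_rewardLaw_regret (B : Bandit N) (S A Aopt : Finset (Fin N)) :
    expect (rewardLaw B) (fun x => roundRegret B ⟨S, A, Aopt, x⟩) =
      ∑ i ∈ Aopt, B.weight i * B.mean i - ∑ i ∈ A, B.weight i * B.mean i := by
  have h : ∀ i, expect (rewardLaw B) (fun x => if x i then (1 : ℝ) else 0) = B.mean i := fun i => by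
    rw [expect_rewardLaw B i fun b => if b then 1 else 0]; simp
  simp only [roundRegret, Round.X, expect_sub, expect_sum, expect_const_mul, h]

/-- The expected regret of a round: charges to the arms, and the queues of the pulled arms compared
with the queues weighted by the constraints. -/
lemma expect_roundRegret_le (hm : 0 < m) (hlam : 0 ≤ lam) (R : ArgmaxRule B m k lam)
    {q : Policy N} (hq : IsFeasible B m k q) {t : ℕ} (h : History N t) {W : ℝ}
    (hW : ∀ i, B.weight i ≤ W) (hW0 : 0 ≤ W) {T : ℕ} (hT : 0 < T) (L : ℕ) :
    expect (roundLaw R q h) (roundRegret B) ≤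
      W * (2 * m * (1 / 2) ^ L + ∑ l ∈ Finset.range L, (1 / 2 : ℝ) ^ (l + 1) * ∑ i,
        (pullCharge T ((1 / 2) ^ (l + 1)) (B.mean i) (succCount h i) (failCount h i) *
            expect (roundLaw R q h) (fun r => pulls i r.pulled) +
          roundCharge T ((1 / 2) ^ (l + 1)) (B.mean i) (succCount h i) (failCount h i))) +
      lam * ∑ i, queue k h i * (expect (roundLaw R q h) (fun r => pulls i r.pulled) - k i) := by
  have e1 : expect (roundLaw R q h) (roundRegret B) =
      expect B.availability fun S => expect (q S) fun Aopt => expect (actionLaw R h S) fun A =>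
        (∑ i ∈ Aopt, (lam * queue k h i + B.weight i * B.mean i) -
          ∑ i ∈ A, (lam * queue k h i + B.weight i * B.mean i)) +
        (lam * ∑ i ∈ A, queue k h i - lam * ∑ i ∈ Aopt, queue k h i) := by
    rw [expect_roundLaw]
    congr 1; funext S
    rw [expect_comm]
    congr 1; funext Aopt; congr 1; funext A
    rw [expect_rewardLaw_regret]
    simp only [Finset.sum_add_distrib, Finset.mul_sum]
    ring
  rw [e1]
  calc _ ≤ expect B.availability fun S => expect (q S) fun Aopt =>
        W * (2 * m * (1 / 2) ^ L + ∑ l ∈ Finset.range L, (1 / 2 : ℝ) ^ (l + 1) * ∑ i,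
          (pullCharge T ((1 / 2) ^ (l + 1)) (B.mean i) (succCount h i) (failCount h i) *
              expect (actionLaw R h S) (pulls i) +
            roundCharge T ((1 / 2) ^ (l + 1)) (B.mean i) (succCount h i) (failCount h i))) +
        (lam * ∑ i, queue k h i * expect (actionLaw R h S) (pulls i) -
          lam * ∑ i ∈ Aopt, queue k h i) := by
        refine expect_mono fun S => expect_mono_of_ne_zero fun Aopt hne => ?_
        rw [expect_add]
        refine add_le_add (expect_actionLaw_gap_le hm hlam R h (hq.1 S Aopt hne) hW hW0 hT L)
          (le_of_eq ?_)
        rw [expect_sub, expect_const_mul, expect_sum_mem, expect_const]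
    _ = W * (2 * m * (1 / 2) ^ L + ∑ l ∈ Finset.range L, (1 / 2 : ℝ) ^ (l + 1) * ∑ i,
          (pullCharge T ((1 / 2) ^ (l + 1)) (B.mean i) (succCount h i) (failCount h i) *
              expect (roundLaw R q h) (fun r => pulls i r.pulled) +
            roundCharge T ((1 / 2) ^ (l + 1)) (B.mean i) (succCount h i) (failCount h i))) +
        (lam * ∑ i, queue k h i * expect (roundLaw R q h) (fun r => pulls i r.pulled) -
          lam * ∑ i, queue k h i * expect B.availability fun S => expect (q S) (pulls i)) := by
        simp only [expect_add, expect_sub, expect_const_mul, expect_sum _ (Finset.range L),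
          expect_sum _ (Finset.univ : Finset (Fin N)), expect_const, expect_sum_mem,
          expect_roundLaw_pulls]
    _ ≤ _ := by
        refine add_le_add_right ?_ _
        rw [← mul_sub, ← Finset.sum_sub_distrib]
        refine mul_le_mul_of_nonneg_left (Finset.sum_le_sum fun i _ => ?_) hlam
        rw [← mul_sub]
        exact mul_le_mul_of_nonneg_left (sub_le_sub_left (le_expect_pulls hq i) _)
          (le_max_right _ _)

lemma regret_eq (R : ArgmaxRule B m k lam) (q : Policy N) (T : ℕ) :
    regret R q T = (1 / T) * ∑ t ∈ Finset.range T,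
      expect (historyLaw R q t) fun h => expect (roundLaw R q h) (roundRegret B) := by
  rw [← expect_historyLaw_sum, ← expect_const_mul]
  rfl

/-! ### The regret bound -/


/-- The total charge to an arm at the level `x`, over all rounds. -/
lemma sum_expect_charge_le (R : ArgmaxRule B m k lam) (q : Policy N) (i : Fin N) {T : ℕ}
    (hT : 1 < T) {x : ℝ} (hx : 0 < x) (hx1 : x ≤ 1 / 2) :
    ∑ t ∈ Finset.range T, expect (historyLaw R q t) (fun h =>
      pullCharge T x (B.mean i) (succCount h i) (failCount h i) *
          expect (roundLaw R q h) (fun r => pulls i r.pulled) +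
        roundCharge T x (B.mean i) (succCount h i) (failCount h i)) ≤
      264 * Real.log T ^ 2 / x ^ 2 := by
  obtain ⟨h0, h1⟩ := B.mean_mem i
  have hδ : (0 : ℝ) < ((T : ℝ) ^ 4)⁻¹ := by positivity
  have hlo : max (B.mean i - x) 0 ≤ 1 := max_le (by linarith) zero_le_one
  have hhi : 0 ≤ min (B.mean i + x) 1 := le_min (by linarith) zero_le_one
  have hp : ∀ s r, 0 ≤ pullCharge T x (B.mean i) s r := fun s r =>
    add_nonneg (missRatio_nonneg hδ (le_max_right _ _) hlo s r) (fewPulls_nonneg _ s r)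
  have hr : ∀ s r, 0 ≤ roundCharge T x (B.mean i) s r := fun s r =>
    add_nonneg (missError_nonneg hδ (le_max_right _ _) hlo s r)
      (lateTail_nonneg hhi (min_le_right _ _) s r)
  have e1 := sum_expect_mul_pulls_le R q i hp T
  have e2 : ∑ t ∈ Finset.range T, expect (historyLaw R q t) (fun h =>
      roundCharge T x (B.mean i) (succCount h i) (failCount h i)) ≤
      T * pathSum (B.mean i) (roundCharge T x (B.mean i)) T 0 0 := by
    refine (Finset.sum_le_sum fun t ht =>
      expect_counts_le R q i hr (Finset.mem_range.1 ht)).trans_eq ?_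
    rw [Finset.sum_const, Finset.card_range, nsmul_eq_mul]
  have e3 : pathSum (B.mean i) (pullCharge T x (B.mean i)) T 0 0 = _ :=
    pathSum_add (B.mean i) (missRatio ((T : ℝ) ^ 4)⁻¹ (max (B.mean i - x) 0))
      (fewPulls (16 * Real.log T / x ^ 2)) T 0 0
  have e4 : pathSum (B.mean i) (roundCharge T x (B.mean i)) T 0 0 = _ :=
    pathSum_add (B.mean i) (missError ((T : ℝ) ^ 4)⁻¹ (max (B.mean i - x) 0))
      (lateTail (16 * Real.log T / x ^ 2) (min (B.mean i + x) 1)) T 0 0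
  rw [e3] at e1
  rw [e4] at e2
  have e5 := pathSum_missRatio_le hT h0 h1 hx hx1
  have e6 := pathSum_fewPulls_le hT h0 hx hx1
  simp only [expect_add, Finset.sum_add_distrib]
  have e7 : (264 : ℝ) * Real.log T ^ 2 / x ^ 2 =
    224 * Real.log T ^ 2 / x ^ 2 + 40 * Real.log T ^ 2 / x ^ 2 := by ring
  rw [e7]
  linarith

/-- The regret in terms of the finest dyadic level `2⁻ᴸ`. -/
lemma mul_regret_le (hm : 0 < m) (hlam : 0 ≤ lam) (R : ArgmaxRule B m k lam) {q : Policy N}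
    (hq : IsFeasible B m k q) {W : ℝ} (hW : ∀ i, B.weight i ≤ W) (hW0 : 0 ≤ W) {T : ℕ}
    (hT : 1 < T) (L : ℕ) :
    T * regret R q T ≤ W * (2 * m * T * (1 / 2) ^ L + 528 * N * Real.log T ^ 2 * 2 ^ L) +
      lam * (N * T / 2) := by
  have hT0 : (T : ℝ) ≠ 0 := by positivity
  rw [regret_eq, ← mul_assoc, mul_one_div_cancel hT0, one_mul]
  have hsum := Finset.sum_le_sum fun t (_ : t ∈ Finset.range T) =>
    expect_mono (p := historyLaw R q t) fun h =>
      expect_roundRegret_le hm hlam R hq h hW hW0 (show 0 < T by omega) L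
  refine hsum.trans ?_
  simp only [expect_add, expect_const_mul]
  rw [Finset.sum_add_distrib, ← Finset.mul_sum, ← Finset.mul_sum]
  refine add_le_add (mul_le_mul_of_nonneg_left ?_ hW0) (mul_le_mul_of_nonneg_left
    (sum_expect_queue_le (le_one_of_isFeasible hq) R q T) hlam)
  simp only [expect_const,
    expect_sum _ (Finset.range L), expect_const_mul, expect_sum _ (Finset.univ : Finset (Fin N))]
  rw [Finset.sum_add_distrib, Finset.sum_const, Finset.card_range, nsmul_eq_mul, Finset.sum_comm]
  refine add_le_add (le_of_eq (by ring)) ?_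
  have hlevel : ∀ l ∈ Finset.range L, ∑ t ∈ Finset.range T, (1 / 2 : ℝ) ^ (l + 1) * ∑ i,
      expect (historyLaw R q t) (fun h =>
        pullCharge T ((1 / 2) ^ (l + 1)) (B.mean i) (succCount h i) (failCount h i) *
            expect (roundLaw R q h) (fun r => pulls i r.pulled) +
          roundCharge T ((1 / 2) ^ (l + 1)) (B.mean i) (succCount h i) (failCount h i)) ≤
      528 * N * Real.log T ^ 2 * 2 ^ l := by
    intro l _
    have hx : (0 : ℝ) < (1 / 2) ^ (l + 1) := by positivity
    have hx1 : (1 / 2 : ℝ) ^ (l + 1) ≤ 1 / 2 := by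
      rw [pow_succ]
      have : (1 / 2 : ℝ) ^ l ≤ 1 := pow_le_one₀ (by norm_num) (by norm_num)
      linarith
    rw [← Finset.mul_sum, Finset.sum_comm]
    refine (mul_le_mul_of_nonneg_left (Finset.sum_le_sum fun i _ =>
      sum_expect_charge_le R q i hT hx hx1) hx.le).trans (le_of_eq ?_)
    rw [Finset.sum_const, Finset.card_univ, Fintype.card_fin, nsmul_eq_mul, pow_succ, one_div,
      inv_pow]
    field_simp
    ring
  refine (Finset.sum_le_sum hlevel).trans ?_
  rw [← Finset.mul_sum]
  refine mul_le_mul_of_nonneg_left ?_ (by positivity)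
  have : ∀ L : ℕ, ∑ l ∈ Finset.range L, (2 : ℝ) ^ l = 2 ^ L - 1 := fun L => by
    rw [geom_sum_eq (by norm_num)]; norm_num
  rw [this]; linarith

/-- The regret bound: the drift of the queues costs `lam * N / 2`, and the balance of the finest
level against the charges is struck at `2⁻ᴸ ≈ √(N / (m T))`. -/
lemma regret_le (hm : 0 < m) (hmN : m ≤ N) {T : ℕ} (hNT : N ≤ T) (hT : 1 < T) (hlam : 0 ≤ lam)
    (R : ArgmaxRule B m k lam) {q : Policy N} (hq : IsFeasible B m k q) :
    regret R q T ≤ lam * N / 2 +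
      1064 * B.maxWeight * Real.log T ^ 2 * (√(m * N * T : ℝ) / T) := by
  have hT0 : (0 : ℝ) < T := by positivity
  have hm0 : (0 : ℝ) < m := by exact_mod_cast hm
  have hm1 : (1 : ℝ) ≤ m := by exact_mod_cast hm
  have hN0 : (0 : ℝ) < N := by exact_mod_cast hm.trans_le hmN
  have hNT' : (N : ℝ) ≤ T := by exact_mod_cast hNT
  have hl := half_le_log hT
  set ell := Real.log T with hell
  have hW : ∀ i, B.weight i ≤ B.maxWeight := fun i =>
    le_ciSup (Set.finite_range B.weight).bddAbove i
  have hW0 : 0 ≤ B.maxWeight := Real.iSup_nonneg B.weight_nonneg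
  set W := B.maxWeight with hWd
  set Y := √(m * N * T : ℝ) with hY
  set ε := √(N / (m * T) : ℝ) with hε
  have hε0 : 0 < ε := Real.sqrt_pos.2 (by positivity)
  have hε1 : ε ≤ 1 := Real.sqrt_le_iff.2 ⟨zero_le_one, by
    rw [one_pow, div_le_one (by positivity)]; nlinarith⟩
  have hsq : ε ^ 2 = N / (m * T) := Real.sq_sqrt (by positivity)
  have e1 : m * T * ε = Y := by
    have : (m * N * T : ℝ) = (m * T * ε) ^ 2 := by rw [mul_pow, hsq]; field_simp
    rw [hY, this, Real.sqrt_sq (by positivity)]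
  have e2 : ε * Y = N := by
    have : ε * (m * T * ε) = m * T * ε ^ 2 := by ring
    rw [← e1, this, hsq]; field_simp
  obtain ⟨n, hn1, hn2⟩ := exists_nat_pow_near_of_lt_one hε0 hε1 (show (0 : ℝ) < 1 / 2 by norm_num)
    (by norm_num)
  have h := mul_regret_le hm hlam R hq hW hW0 hT (n + 1)
  have hY0 : 0 ≤ Y := Real.sqrt_nonneg _
  have hpow : (N : ℝ) * 2 ^ (n + 1) ≤ 2 * Y := by
    have h2 : ε * 2 ^ n ≤ 1 := by
      calc ε * 2 ^ n ≤ (1 / 2) ^ n * 2 ^ n := by gcongr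
        _ = 1 := by rw [← mul_pow]; norm_num
    rw [← e2, pow_succ]
    nlinarith
  have hfine : m * T * (1 / 2 : ℝ) ^ (n + 1) ≤ Y := by
    rw [← e1]; gcongr
  have hbr : 2 * m * T * (1 / 2) ^ (n + 1) + 528 * N * ell ^ 2 * 2 ^ (n + 1) ≤
      1064 * ell ^ 2 * Y := by
    have h3 : 528 * ell ^ 2 * ((N : ℝ) * 2 ^ (n + 1)) ≤ 528 * ell ^ 2 * (2 * Y) :=
      mul_le_mul_of_nonneg_left hpow (by positivity)
    have h4 : (1 : ℝ) ≤ 4 * ell ^ 2 := by nlinarith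
    nlinarith
  have hfinal : T * regret R q T ≤ T * (lam * N / 2 + 1064 * W * ell ^ 2 * (Y / T)) := by
    refine h.trans ((add_le_add_left (mul_le_mul_of_nonneg_left hbr hW0) _).trans (le_of_eq ?_))
    field_simp
    ring
  exact le_of_mul_le_mul_left hfinal hT0

/-- The fairness term for `η` at or above the threshold. -/
lemma fairness_term_le {N m T : ℕ} (hm : 0 < m) (hmN : m ≤ N) (hT : 1 < T) {η : ℝ}
    (hη : √((N * T : ℝ) / (m * Real.log T)) ≤ η) :
    0 < η ∧ N / (2 * η) ≤ 1 / 2 * √(Real.log T) * (√(m * N * T : ℝ) / T) := by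
  have hT0 : (0 : ℝ) < T := by positivity
  have hm0 : (0 : ℝ) < m := by exact_mod_cast hm
  have hN0 : (0 : ℝ) < N := by exact_mod_cast hm.trans_le hmN
  have hl : 0 < Real.log T := by linarith [half_le_log hT]
  have hs : 0 < √((N * T : ℝ) / (m * Real.log T)) := Real.sqrt_pos.2 (by positivity)
  have hη0 := hs.trans_le hη
  refine ⟨hη0, ?_⟩
  have e : √(Real.log T) * √(m * N * T : ℝ) * √((N * T : ℝ) / (m * Real.log T)) = N * T := by
    rw [← Real.sqrt_mul hl.le, ← Real.sqrt_mul (by positivity),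
      ← Real.sqrt_sq (show (0 : ℝ) ≤ N * T by positivity)]
    congr 1; rw [Real.sqrt_sq (by positivity)]; field_simp
  have h : (N : ℝ) * T ≤ √(Real.log T) * √(m * N * T : ℝ) * η := by
    rw [← e]; gcongr
  have e2 : 1 / 2 * √(Real.log T) * (√(m * N * T : ℝ) / T) =
      (√(Real.log T) * √(m * N * T : ℝ)) / (2 * T) := by field_simp
  rw [e2, div_le_div_iff₀ (by positivity) (by positivity)]
  linarith

end CSMAB

theorem corollary1 :
    ∃ (C : ℝ) (c : ℕ), 0 < C ∧
      ∀ (N m T : ℕ), 0 < m → m ≤ N → N ≤ T → 1 < T → ∀ B : CSMAB.Bandit N,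
        -- finite `η`, with fairness constraints `k`
        (∀ (k : Fin N → ℝ) (η : ℝ), √((N * T : ℝ) / (m * Real.log T)) ≤ η →
          ∀ (R : CSMAB.ArgmaxRule B m k (1 / η)) (q : CSMAB.Policy N),
            CSMAB.IsOptimalPolicy B m k q →
              CSMAB.regret R q T ≤
                  C * (1 + B.maxWeight) * Real.log T ^ c * (√(m * N * T : ℝ) / T) ∧
              CSMAB.regret R q T ≤
                  N / (2 * η) + C * B.maxWeight * Real.log T ^ c * (√(m * N * T : ℝ) / T) ∧
              N / (2 * η) ≤ 1 / 2 * √(Real.log T) * (√(m * N * T : ℝ) / T)) ∧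
        -- `η = ∞`, no fairness constraints
        (∀ (R : CSMAB.ArgmaxRule B m 0 0) (q : CSMAB.Policy N),
            CSMAB.IsOptimalPolicy B m 0 q →
              CSMAB.regret R q T ≤
                C * B.maxWeight * Real.log T ^ c * (√(m * N * T : ℝ) / T)) := by
  refine ⟨1064, 2, by norm_num, fun N m T hm hmN hNT hT B => ⟨fun k η hη R q hq => ?_,
    fun R q hq => ?_⟩⟩
  · obtain ⟨hη0, hfair⟩ := CSMAB.fairness_term_le hm hmN hT hη
    have h := CSMAB.regret_le hm hmN hNT hT (one_div_nonneg.2 hη0.le) R hq.1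
    have e : 1 / η * N / 2 = N / (2 * η) := by field_simp
    rw [e] at h
    refine ⟨?_, h, hfair⟩
    have hl := CSMAB.half_le_log hT
    have hY : 0 ≤ √(m * N * T : ℝ) / T := by positivity
    -- `log T` is bounded below, so the fairness term is absorbed by the factor `log T ^ 2`
    have hsq : √(Real.log T) ≤ 8 * Real.log T ^ 2 :=
      Real.sqrt_le_iff.2 ⟨by positivity, by
        have h1 : 1 ≤ 64 * Real.log T ^ 3 := by
          have := pow_le_pow_left₀ (by norm_num) hl 3
          norm_num at this; linarith
        have h2 : 0 ≤ Real.log T := by linarith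
        nlinarith [mul_le_mul_of_nonneg_left h1 h2]⟩
    have := mul_le_mul_of_nonneg_right hsq hY
    have h0 : 0 ≤ Real.log T ^ 2 * (√(m * N * T : ℝ) / T) := by positivity
    linarith
  · simpa using CSMAB.regret_le hm hmN hNT hT le_rfl R hq.1
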